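/- Let $\mathcal H$ be the Heisenberg Lie algebra over $\mathbb Z$, i.e. the free $\mathbb Z$-module with basis $x,y,z$ and bracket $[x,y]=z$, $[x,z]=[y,z]=0$ (equivalently $F/[F,[F,F]]$ with $F$ the free Lie algebra on two generators). For a prime $p$ put $\mathcal H_p=\mathcal H\otimes\mathbb Z_p$, and put $\widehat{\mathcal H}=\mathcal H\otimes\widehat{\mathbb Z}=\prod_p\mathcal H_p$. Let $\Gamma_{\mathcal H}$ (resp. $\Gamma_{\mathcal H_p}$) be the group of Lie algebra automorphisms of $\mathcal H$ over $\mathbb Z$ (resp. of $\mathcal H_p$ over $\mathbb Z_p$), and let $\Delta_{\mathcal H}$ (resp. $\Delta_{\mathcal H_p}$) be the monoid of automorphisms $\alpha$ of $\mathcal H\otimes\mathbb Q$ (resp. of $\mathcal H_p\otimes\mathbb Q_p$) that map $\mathcal H$ (resp. $\mathcal H_p$) into itself; automorphisms act on the right, $x\mapsto x^{\alpha}$. Let $\widehat\Gamma_{\mathcal H}=\prod_p\Gamma_{\mathcal H_p}$, and let $\widehat\Delta_{\mathcal H}$ be the restricted product of the $\Delta_{\mathcal H_p}$ with respect to the $\Gamma_{\mathcal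 H_p}$. For each of these three kinds of pairs $(\Gamma,\Delta)$ every double coset $\Gamma\alpha\Gamma$ with $\alpha\in\Delta$ is a finite union of cosets $\Gamma\alpha_i$; let $R_{\mathcal H}$, $R_{\mathcal H_p}$, $\widehat R_{\mathcal H}$ be the Hecke rings $R(\Gamma,\Delta)$ of $(\Gamma_{\mathcal H},\Delta_{\mathcal H})$, $(\Gamma_{\mathcal H_p},\Delta_{\mathcal H_p})$, $(\widehat\Gamma_{\mathcal H},\widehat\Delta_{\mathcal H})$, i.e. the free abelian groups on the double cosets, with Shimura's multiplication. For $n\ge 1$ let $T_{\mathcal H}(n)\in R_{\mathcal H}$ be the (finite) sum of all double cosets $\Gamma_{\mathcal H}\alpha\Gamma_{\mathcal H}$ in $\Delta_{\mathcal H}$ with $[\mathcal H:\mathcal H^{\alpha}]=n$, and define $\widehat T_{\mathcal H}(n)\in\widehat R_{\mathcal H}$ and $T_{\mathcal H_p}(p^k)\in R_{\mathcal H_p}$ in the same way. Consider the formal series $$D_{\mathcal H}(s)=\sum_{n\ge1}T_{\mathcal H}(n)n^{-s},\qquad \widehat D_{\mathcal H}(s)=\sum_{n\ge1}\widehat T_{\mathcal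 H}(n)n^{-s},\qquad P_{\mathcal H_p}(X)=\sum_{k\ge0}T_{\mathcal H_p}(p^k)X^k .$$ The canonical inclusion $\Delta_{\mathcal H_p}\subset\widehat\Delta_{\mathcal H}$ induces an injective ring homomorphism $R_{\mathcal H_p}\to\widehat R_{\mathcal H}$ which sends the double coset of $\alpha$ to the double coset of $\alpha$. The diagonal embedding $\eta:\Delta_{\mathcal H}\to\widehat\Delta_{\mathcal H}$ induces an injective ring homomorphism $\eta^*:\widehat R_{\mathcal H}\to R_{\mathcal H}$ which sends a double coset $\widehat\Gamma_{\mathcal H}\widehat\alpha\,\widehat\Gamma_{\mathcal H}$ to the sum of all double cosets $\Gamma_{\mathcal H}\beta\Gamma_{\mathcal H}$ contained in $\eta^{-1}(\widehat\Gamma_{\mathcal H}\widehat\alpha\,\widehat\Gamma_{\mathcal H})$. Under the identifications of $R_{\mathcal H_p}$ with a subring of $\widehat R_{\mathcal H}$ and of $\widehat R_{\mathcal H}$ with a subring of $R_{\mathcal H}$ given by these homomorphisms, $$D_{\mathcal H}(s)=\widehat D_{\mathcal H}(s)=\prod_pP_{\mathcal H_p}(p^{-s}),$$ as formal Dirichlet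 series with coefficients in $\widehat R_{\mathcal H}$ and in $R_{\mathcal H}$. Here $p$ runs over all primes, and the infinite product means that, for every $n$, the coefficient of $n^{-s}$ in the product over a finite set of primes, taken in any order, is the stated one as soon as the finite set is large enough. -/

import Mathlib

open scoped TensorProduct

/-! ## Abstract Hecke rings

`M` is a monoid (written `Δ` in the comments) and `Γ = Δˣ` is its group of invertible elements.
All the pairs `(Γ, Δ)` considered below are of this form.  We follow the usual convention:
`Γ\Δ` is the set of cosets `Γα`, and the product in the Hecke ring is computed from
`ΓαΓ = ⊔ Γαᵢ`, `ΓβΓ = ⊔ Γβⱼ` by means of the products `Γαᵢβⱼ`. -/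

namespace Hecke

section Abstract

variable (M : Type*) [Monoid M]

/-- `a` and `b` lie in the same coset: `Γa = Γb`, where `Γ = Mˣ`. -/
def cosetSetoid : Setoid M where
  r a b := ∃ u : Mˣ, (u : M) * a = b
  iseqv :=
    { refl := fun a => ⟨1, by simp⟩
      symm := by
        rintro a b ⟨u, rfl⟩
        exact ⟨u⁻¹, by simp⟩
      trans := by
        rintro a b c ⟨u, rfl⟩ ⟨v, rfl⟩
        exact ⟨v * u, by simp [mul_assoc]⟩ }

/-- The set `Γ\Δ` of cosets `Γa`. -/
def Coset : Type _ := Quotient (cosetSetoid M)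

/-- `a` and `b` lie in the same double coset: `ΓaΓ = ΓbΓ`, where `Γ = Mˣ`. -/
def doubleCosetSetoid : Setoid M where
  r a b := ∃ u v : Mˣ, (u : M) * a * (v : M) = b
  iseqv :=
    { refl := fun a => ⟨1, 1, by simp⟩
      symm := by
        rintro a b ⟨u, v, rfl⟩
        exact ⟨u⁻¹, v⁻¹, by simp [mul_assoc]⟩
      trans := by
        rintro a b c ⟨u, v, rfl⟩ ⟨u', v', rfl⟩
        exact ⟨u' * u, v * v', by simp [mul_assoc]⟩ }

/-- The set `Γ\Δ/Γ` of double cosets `ΓaΓ`. -/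
def DoubleCoset : Type _ := Quotient (doubleCosetSetoid M)

variable {M}

/-- The coset `Γa`. -/
def Coset.mk (a : M) : Coset M := Quotient.mk (cosetSetoid M) a

/-- The double coset `ΓaΓ`. -/
def DoubleCoset.mk (a : M) : DoubleCoset M := Quotient.mk (doubleCosetSetoid M) a

/-- The double coset containing a given coset. -/
def Coset.toDouble : Coset M → DoubleCoset M :=
  Quotient.lift DoubleCoset.mk (by
    rintro a b ⟨u, rfl⟩
    exact Quotient.sound ⟨u, 1, by simp⟩)

/-- Right translation `Γa ↦ Γab` on cosets. -/
def Coset.translate (b : M) : Coset M → Coset M :=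
  Quotient.lift (fun a => Coset.mk (a * b)) (by
    rintro a a' ⟨u, rfl⟩
    exact Quotient.sound ⟨u, by simp [mul_assoc]⟩)

@[simp] theorem Coset.translate_mk (b a : M) :
    Coset.translate b (Coset.mk a) = Coset.mk (a * b) := rfl

@[simp] theorem Coset.toDouble_mk (a : M) : (Coset.mk a).toDouble = DoubleCoset.mk a := rfl

theorem Coset.mk_surj (c : Coset M) : ∃ a : M, Coset.mk a = c := Quotient.exists_rep c

theorem Coset.mk_unit_mul (u : Mˣ) (a : M) : Coset.mk ((u : M) * a) = Coset.mk a :=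
  (Quotient.sound ⟨u, rfl⟩ : Coset.mk a = Coset.mk ((u : M) * a)).symm

/-- The right action of `b ∈ Δ` on the free abelian group `ℤ[Γ\Δ]`: `Σ cᵢ Γaᵢ ↦ Σ cᵢ Γaᵢb`. -/
noncomputable def rightAct (b : M) : (Coset M →₀ ℤ) →+ (Coset M →₀ ℤ) :=
  Finsupp.mapDomain.addMonoidHom (Coset.translate b)

@[simp] theorem rightAct_single (b a : M) (n : ℤ) :
    rightAct b (Finsupp.single (Coset.mk a) n) = Finsupp.single (Coset.mk (a * b)) n := by
  simp [rightAct, Finsupp.mapDomain_single]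

theorem addHom_ext_mk {A : Type*} [AddCommGroup A] {f g : (Coset M →₀ ℤ) →+ A}
    (h : ∀ a : M, f (Finsupp.single (Coset.mk a) 1) = g (Finsupp.single (Coset.mk a) 1)) :
    f = g := by
  refine Finsupp.addHom_ext fun c n => ?_
  obtain ⟨a, rfl⟩ := c.mk_surj
  have hn : (Finsupp.single (Coset.mk a) n : Coset M →₀ ℤ)
      = n • Finsupp.single (Coset.mk a) 1 := by simp
  rw [hn, map_zsmul, map_zsmul, h]

theorem rightAct_mul (a b : M) (x : Coset M →₀ ℤ) :
    rightAct (a * b) x = rightAct b (rightAct a x) := by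
  have : rightAct (a * b) = (rightAct b).comp (rightAct a) :=
    addHom_ext_mk fun c => by simp [mul_assoc]
  exact DFunLike.congr_fun this x

theorem rightAct_one (x : Coset M →₀ ℤ) : rightAct (1 : M) x = x := by
  have : rightAct (1 : M) = AddMonoidHom.id _ := addHom_ext_mk fun c => by simp
  exact DFunLike.congr_fun this x

variable (M)

/-- The subgroup `ℤ[Γ\Δ]^Γ` of the elements of `ℤ[Γ\Δ]` fixed by right translation by `Γ`. These
are the finite `ℤ`-linear combinations of double cosets `ΓaΓ`, where a double coset which is the
disjoint union of `Γa₁, …, Γaₖ` is identified with `Γa₁ + ⋯ + Γaₖ`. -/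
def invariants : AddSubgroup (Coset M →₀ ℤ) where
  carrier := {x | ∀ u : Mˣ, rightAct (u : M) x = x}
  zero_mem' := fun u => map_zero _
  add_mem' := fun hx hy u => by rw [map_add, hx u, hy u]
  neg_mem' := fun hx u => by rw [map_neg, hx u]

end Abstract

end Hecke

/-- The Hecke ring `R(Γ, Δ)` of `Δ = M` with respect to `Γ = Mˣ`. -/
def HeckeAlg (M : Type*) [Monoid M] : Type _ := ↥(Hecke.invariants M)

namespace HeckeAlg

variable {M : Type*} [Monoid M]

noncomputable instance : AddCommGroup (HeckeAlg M) :=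
  inferInstanceAs (AddCommGroup ↥(Hecke.invariants M))

/-- The underlying element of `ℤ[Γ\Δ]`. -/
noncomputable def val : HeckeAlg M →+ (Hecke.Coset M →₀ ℤ) := (Hecke.invariants M).subtype

theorem val_injective : Function.Injective (val (M := M)) := Subtype.val_injective

theorem rightAct_val (x : HeckeAlg M) (u : Mˣ) : Hecke.rightAct (u : M) (val x) = val x := x.2 u

/-- The coefficient of `x` at the coset `Γa`, equivalently at the double coset `ΓaΓ`. -/
noncomputable def coeff (x : HeckeAlg M) (a : M) : ℤ := val x (Hecke.Coset.mk a)

/-- For `x = Σ cᵢ Γaᵢ` fixed by `Γ` and a coset `Γb`, the element `Σ cᵢ Γaᵢb`. -/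
noncomputable def mulCoset (x : HeckeAlg M) : Hecke.Coset M → (Hecke.Coset M →₀ ℤ) :=
  Quotient.lift (fun b : M => Hecke.rightAct b (val x)) (by
    rintro a b ⟨u, rfl⟩
    rw [Hecke.rightAct_mul, rightAct_val])

@[simp] theorem mulCoset_mk (x : HeckeAlg M) (b : M) :
    mulCoset x (Hecke.Coset.mk b) = Hecke.rightAct b (val x) := rfl

/-- Multiplication `(Σᵢ cᵢ Γaᵢ, Σⱼ dⱼ Γbⱼ) ↦ Σᵢⱼ cᵢ dⱼ Γaᵢbⱼ`, for `Σᵢ cᵢ Γaᵢ` fixed by `Γ`. -/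
noncomputable def mulVal (x : HeckeAlg M) : (Hecke.Coset M →₀ ℤ) →+ (Hecke.Coset M →₀ ℤ) :=
  Finsupp.liftAddHom fun c => (zmultiplesHom _ (mulCoset x c) : ℤ →+ (Hecke.Coset M →₀ ℤ))

@[simp] theorem mulVal_single (x : HeckeAlg M) (b : M) (n : ℤ) :
    mulVal x (Finsupp.single (Hecke.Coset.mk b) n) = n • Hecke.rightAct b (val x) := by
  simp [mulVal]

theorem mulVal_rightAct (x : HeckeAlg M) (b : M) (y : Hecke.Coset M →₀ ℤ) :
    mulVal x (Hecke.rightAct b y) = Hecke.rightAct b (mulVal x y) := by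
  have : (mulVal x).comp (Hecke.rightAct b) = (Hecke.rightAct b).comp (mulVal x) :=
    Hecke.addHom_ext_mk fun a => by simp [Hecke.rightAct_mul]
  exact DFunLike.congr_fun this y

noncomputable instance : Mul (HeckeAlg M) :=
  ⟨fun x y => ⟨mulVal x (val y), fun u => by rw [← mulVal_rightAct, rightAct_val]⟩⟩

noncomputable instance : One (HeckeAlg M) :=
  ⟨⟨Finsupp.single (Hecke.Coset.mk 1) 1, fun u => by
    rw [Hecke.rightAct_single, one_mul]
    simpa using congrArg (fun c => Finsupp.single c (1 : ℤ)) (Hecke.Coset.mk_unit_mul u 1)⟩⟩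

theorem val_mul (x y : HeckeAlg M) : val (x * y) = mulVal x (val y) := rfl

theorem val_one : val (1 : HeckeAlg M) = Finsupp.single (Hecke.Coset.mk 1) 1 := rfl

theorem mulVal_mul (x y : HeckeAlg M) (z : Hecke.Coset M →₀ ℤ) :
    mulVal (x * y) z = mulVal x (mulVal y z) := by
  have : mulVal (x * y) = (mulVal x).comp (mulVal y) :=
    Hecke.addHom_ext_mk fun a => by simp [val_mul, mulVal_rightAct]
  exact DFunLike.congr_fun this z

theorem mulVal_one (z : Hecke.Coset M →₀ ℤ) : mulVal (1 : HeckeAlg M) z = z := by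
  have : mulVal (1 : HeckeAlg M) = AddMonoidHom.id _ :=
    Hecke.addHom_ext_mk fun a => by simp [val_one]
  exact DFunLike.congr_fun this z

theorem mulVal_add (x y : HeckeAlg M) (z : Hecke.Coset M →₀ ℤ) :
    mulVal (x + y) z = mulVal x z + mulVal y z := by
  have : mulVal (x + y) = mulVal x + mulVal y :=
    Hecke.addHom_ext_mk fun a => by simp
  exact DFunLike.congr_fun this z

noncomputable instance : Ring (HeckeAlg M) :=
  { (inferInstance : AddCommGroup (HeckeAlg M)) with
    mul := (· * ·)
    one := 1
    left_distrib := fun x y z => val_injective (by simp [val_mul])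
    right_distrib := fun x y z => val_injective (by simp [val_mul, mulVal_add])
    zero_mul := fun x => val_injective (by
      have h := mulVal_add 0 0 (val x)
      rw [add_zero] at h
      simpa [val_mul] using h)
    mul_zero := fun x => val_injective (by simp [val_mul])
    mul_assoc := fun x y z => val_injective (by simp [val_mul, mulVal_mul])
    one_mul := fun x => val_injective (by rw [val_mul, mulVal_one])
    mul_one := fun x => val_injective (by
      rw [val_mul, val_one, mulVal_single, Hecke.rightAct_one, one_smul]) }

open scoped Classical in
/-- The indicator function of the set of the cosets `Γa` contained in a double coset `D`
(`0` if this set is infinite). -/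
noncomputable def indicatorVal (D : Hecke.DoubleCoset M) : Hecke.Coset M →₀ ℤ :=
  if h : {c : Hecke.Coset M | c.toDouble = D}.Finite then
    Finsupp.indicator h.toFinset (fun _ _ => 1) else 0

theorem rightAct_indicatorVal (D : Hecke.DoubleCoset M) (u : Mˣ) :
    Hecke.rightAct (u : M) (indicatorVal D) = indicatorVal D := by
  classical
  unfold indicatorVal
  split_ifs with h
  · have hinv : ∀ (v : Mˣ) (c : Hecke.Coset M),
        (Hecke.Coset.translate (v : M) c).toDouble = c.toDouble := by
      intro v c
      obtain ⟨a, rfl⟩ := c.mk_surj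
      exact (Quotient.sound ⟨1, v, by simp⟩ :
        Hecke.DoubleCoset.mk a = Hecke.DoubleCoset.mk (a * (v : M))).symm
    have hcomp : ∀ (v : Mˣ) (c : Hecke.Coset M),
        Hecke.Coset.translate (v : M) (Hecke.Coset.translate ((v⁻¹ : Mˣ) : M) c) = c := by
      intro v c
      obtain ⟨a, rfl⟩ := c.mk_surj
      simp [mul_assoc]
    have hinj : Function.Injective (Hecke.Coset.translate (u : M)) := by
      refine Function.LeftInverse.injective
        (g := Hecke.Coset.translate ((u⁻¹ : Mˣ) : M)) fun c => ?_
      simpa using hcomp u⁻¹ c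
    ext c
    obtain ⟨d, rfl⟩ : ∃ d, Hecke.Coset.translate (u : M) d = c := ⟨_, hcomp u c⟩
    change Finsupp.mapDomain _ _ _ = _
    rw [Finsupp.mapDomain_apply hinj]
    simp [Finsupp.indicator_apply, hinv]
  · simp

/-- The double coset `D = ΓaΓ`, as an element of the Hecke ring. -/
noncomputable def single (D : Hecke.DoubleCoset M) : HeckeAlg M :=
  ⟨indicatorVal D, rightAct_indicatorVal D⟩

/-- `T(a) = ΓaΓ`, as an element of the Hecke ring. -/
noncomputable def T (a : M) : HeckeAlg M := single (Hecke.DoubleCoset.mk a)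

end HeckeAlg

namespace Hecke

variable {M : Type*} [Monoid M]

/-- The double cosets `ΓaΓ` such that `a` has index `n`. -/
def doubleCosetsOfIndex (idx : M → ℕ) (n : ℕ) : Set (DoubleCoset M) :=
  {D | ∃ a : M, DoubleCoset.mk a = D ∧ idx a = n}

/-- The sum of the double cosets `ΓaΓ` (as elements of the Hecke ring) such that `a` has
index `n`. -/
noncomputable def sumOfIndex (idx : M → ℕ) (n : ℕ) : HeckeAlg M :=
  ∑ᶠ D ∈ doubleCosetsOfIndex idx n, HeckeAlg.single D

/-- The sums defining double cosets as elements of `ℤ[Γ\Δ]` and those defining `sumOfIndex` are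
finite: every double coset is a finite union of cosets, and there are only finitely many double
cosets of any given finite index. -/
def FinitenessConditions (idx : M → ℕ) : Prop :=
  (∀ D : DoubleCoset M, {c : Coset M | c.toDouble = D}.Finite) ∧
    (∀ a : M, 0 < idx a) ∧ ∀ n : ℕ, 0 < n → (doubleCosetsOfIndex idx n).Finite

/-- The formal Dirichlet series `Σ_{n > 0} T(n) n⁻ˢ` with `T(n) = sumOfIndex idx n`. Formal
Dirichlet series are represented by their sequences of coefficients, and multiplied by Dirichlet
convolution. -/
noncomputable def dirichletSeries (idx : M → ℕ) : ArithmeticFunction (HeckeAlg M) :=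
  ⟨fun n => if n = 0 then 0 else sumOfIndex idx n, if_pos rfl⟩

/-- The formal power series `Σ_{k ≥ 0} T(pᵏ) Xᵏ` with `T(pᵏ) = sumOfIndex idx (pᵏ)`. -/
noncomputable def powerSeries (idx : M → ℕ) (p : ℕ) : PowerSeries (HeckeAlg M) :=
  PowerSeries.mk fun k => sumOfIndex idx (p ^ k)

end Hecke

/-! ## Formal Euler products -/

/-- The formal Dirichlet series `P(p⁻ˢ) = Σₖ cₖ p⁻ᵏˢ` obtained from the power series
`P = Σₖ cₖ Xᵏ`. -/
noncomputable def evalPrimePow {A : Type*} [Semiring A] (p : Nat.Primes) (P : PowerSeries A) :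
    ArithmeticFunction A :=
  ⟨Function.extend (fun k : ℕ => (p : ℕ) ^ k) (fun k => PowerSeries.coeff k P) 0,
    Function.extend_apply' _ _ _ (by
      rintro ⟨k, hk⟩
      exact pow_ne_zero k p.2.ne_zero hk)⟩

/-- `D = ∏ₚ F p` as formal Dirichlet series with coefficients in a possibly noncommutative ring:
for every `n`, the `n`-th coefficient of the product of the `F p` over any finite set of primes,
taken in any order, is equal to that of `D` as soon as the finite set is large enough. -/
def HasFormalEulerProduct {A : Type*} [Semiring A] (F : Nat.Primes → ArithmeticFunction A)
    (D : ArithmeticFunction A) : Prop :=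
  ∀ n : ℕ, ∃ S : Finset Nat.Primes, ∀ l : List Nat.Primes, l.Nodup → (∀ p ∈ S, p ∈ l) →
    (l.map F).prod n = D n

/-! ## The monoids attached to a Lie algebra -/

/-- The monoid `Δ` of the injective Lie algebra endomorphisms of an `R`-Lie algebra `L`. If `R` is
a domain with fraction field `K` and `L` is free of finite rank, these are the automorphisms of the
`K`-Lie algebra `L ⊗ K` which map `L` into itself. The invertible elements of this monoid are the
automorphisms of `L`. -/
structure InjEnd (R L : Type*) [CommRing R] [LieRing L] [LieAlgebra R L] where
  /-- The underlying endomorphism. -/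
  toLieHom : L →ₗ⁅R⁆ L
  injective : Function.Injective toLieHom

namespace InjEnd

section

variable {R L : Type*} [CommRing R] [LieRing L] [LieAlgebra R L]

@[ext] theorem ext {α β : InjEnd R L} (h : ∀ x, α.toLieHom x = β.toLieHom x) : α = β := by
  cases α
  cases β
  congr 1
  exact LieHom.ext h

/-- Endomorphisms act on the right: `α * β` is `α` followed by `β`, i.e. `x ^ (αβ) = (x ^ α) ^ β`. -/
instance : Monoid (InjEnd R L) where
  mul α β := ⟨β.toLieHom.comp α.toLieHom, β.injective.comp α.injective⟩
  one := ⟨LieHom.id, Function.injective_id⟩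
  mul_assoc _ _ _ := rfl
  one_mul _ := rfl
  mul_one _ := rfl

theorem mul_apply (α β : InjEnd R L) (x : L) :
    (α * β).toLieHom x = β.toLieHom (α.toLieHom x) := rfl

theorem one_apply (x : L) : (1 : InjEnd R L).toLieHom x = x := rfl

/-- The image `L ^ α`. -/
def image (α : InjEnd R L) : AddSubgroup L :=
  (α.toLieHom : L →ₗ[R] L).range.toAddSubgroup

/-- The index `[L : L ^ α]`. -/
noncomputable def index (α : InjEnd R L) : ℕ := α.image.index

/-- The invertible elements of the monoid are exactly the automorphisms of `L`. -/
theorem isUnit_iff (α : InjEnd R L) : IsUnit α ↔ Function.Bijective α.toLieHom := by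
  constructor
  · rintro ⟨u, rfl⟩
    refine ⟨u.val.injective, fun x => ⟨(u⁻¹).val.toLieHom x, ?_⟩⟩
    rw [← mul_apply, Units.inv_mul, one_apply]
  · intro h
    let e : L ≃ₗ⁅R⁆ L := LieEquiv.ofBijective α.toLieHom h
    refine ⟨⟨α, ⟨(e.symm : L →ₗ⁅R⁆ L), e.symm.injective⟩, ?_, ?_⟩, rfl⟩
    · ext x
      exact e.symm_apply_apply x
    · ext x
      exact e.apply_symm_apply x

end

end InjEnd

section Global

instance Nat.Primes.instFactPrime (p : Nat.Primes) : Fact (p : ℕ).Prime := ⟨p.2⟩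

variable (L : Type*) [LieRing L]

/-- `L_p = ℤ_p ⊗ L`, a Lie algebra over `ℤ_p`. -/
abbrev LocalLie (p : Nat.Primes) : Type _ := ℤ_[(p : ℕ)] ⊗[ℤ] L

/-- The monoid `Δ_L`. -/
abbrev GlobalMonoid : Type _ := InjEnd ℤ L

/-- The monoid `Δ_{L_p}`. -/
abbrev LocalMonoid (p : Nat.Primes) : Type _ := InjEnd ℤ_[(p : ℕ)] (LocalLie L p)

/-- The monoid `Δ̂_L`: the restricted product of the monoids `Δ_{L_p}` over all primes with respect
to their subgroups `Γ_{L_p}` of invertible elements. It acts on `∏ₚ L_p`, which is `L ⊗ ℤ̂`.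
Its group of invertible elements is `Γ̂_L = ∏ₚ Γ_{L_p}`. -/
def AdelicMonoid : Submonoid (∀ p : Nat.Primes, LocalMonoid L p) where
  carrier := {α | {p | ¬ IsUnit (α p)}.Finite}
  one_mem' := by simp
  mul_mem' := by
    intro α β hα hβ
    refine (hα.union hβ).subset fun p hp => ?_
    by_contra h
    simp only [Set.mem_union, Set.mem_ofPred_eq, not_or, not_not] at h
    exact hp (h.1.mul h.2)

variable {L}

/-- The index of `(∏ₚ L_p) ^ α = ∏ₚ (L_p ^ αₚ)` in `∏ₚ L_p`. -/
noncomputable def AdelicMonoid.index (α : AdelicMonoid L) : ℕ :=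
  (AddSubgroup.pi Set.univ fun p => (α.1 p).image).index

open scoped Classical in
/-- The canonical inclusion `Δ_{L_p} → Δ̂_L`: the component at `p` is the given element, the other
components are trivial. -/
noncomputable def LocalMonoid.toAdelic (p : Nat.Primes) (α : LocalMonoid L p) : AdelicMonoid L :=
  ⟨Pi.mulSingle p α, by
    refine (Set.finite_singleton p).subset fun q hq => ?_
    by_contra h
    refine hq ?_
    rw [Pi.mulSingle_eq_of_ne (M := fun q : Nat.Primes => LocalMonoid L q) h]
    exact isUnit_one⟩

/-- The extension of scalars `1 ⊗ f` of a Lie algebra endomorphism. -/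
noncomputable def lieBaseChange (f : L →ₗ⁅ℤ⁆ L) (p : Nat.Primes) :
    LocalLie L p →ₗ⁅ℤ_[(p : ℕ)]⁆ LocalLie L p :=
  { (f : L →ₗ[ℤ] L).baseChange ℤ_[(p : ℕ)] with
    map_lie' := fun {x y} =>
      (LieAlgebra.ExtendScalars.map (AlgHom.id ℤ ℤ_[(p : ℕ)]) f).map_lie x y }

theorem lieBaseChange_apply (f : L →ₗ⁅ℤ⁆ L) (p : Nat.Primes) (x : LocalLie L p) :
    lieBaseChange f p x = (f : L →ₗ[ℤ] L).baseChange ℤ_[(p : ℕ)] x := rfl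

variable [Module.Free ℤ L] [Module.Finite ℤ L]

theorem det_ne_zero_of_injEnd (α : GlobalMonoid L) :
    LinearMap.det (α.toLieHom : L →ₗ[ℤ] L) ≠ 0 := by
  intro h
  exact LinearMap.det_eq_zero_iff_ker_ne_bot.mp h (LinearMap.ker_eq_bot.mpr α.injective)

/-- The natural map `Δ_L → Δ_{L_p}`, `α ↦ 1 ⊗ α`. -/
noncomputable def GlobalMonoid.toLocal (α : GlobalMonoid L) (p : Nat.Primes) : LocalMonoid L p :=
  ⟨lieBaseChange α.toLieHom p, by
    have h : LinearMap.ker ((α.toLieHom : L →ₗ[ℤ] L).baseChange ℤ_[(p : ℕ)]) = ⊥ := by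
      by_contra h
      have h' := LinearMap.det_eq_zero_iff_ker_ne_bot.mpr h
      rw [LinearMap.det_baseChange] at h'
      exact det_ne_zero_of_injEnd α (by simpa using h')
    exact LinearMap.ker_eq_bot.mp h⟩

theorem GlobalMonoid.isUnit_toLocal (α : GlobalMonoid L) (p : Nat.Primes)
    (hp : ¬ ((p : ℕ) : ℤ) ∣ LinearMap.det (α.toLieHom : L →ₗ[ℤ] L)) :
    IsUnit (α.toLocal p) := by
  rw [InjEnd.isUnit_iff]
  have h : IsUnit ((α.toLieHom : L →ₗ[ℤ] L).baseChange ℤ_[(p : ℕ)]) := by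
    rw [LinearMap.isUnit_iff_isUnit_det, LinearMap.det_baseChange]
    rw [← PadicInt.norm_int_lt_one_iff_dvd, ← PadicInt.not_isUnit_iff, not_not] at hp
    simpa using hp
  exact (Module.End.isUnit_iff _).mp h

/-- The diagonal embedding `Δ_L → Δ̂_L`. -/
noncomputable def GlobalMonoid.toAdelic (α : GlobalMonoid L) : AdelicMonoid L :=
  ⟨fun p => α.toLocal p, by
    refine ((Finset.finite_toSet
      (LinearMap.det (α.toLieHom : L →ₗ[ℤ] L)).natAbs.primeFactors).preimage (f := fun p : Nat.Primes => (p : ℕ))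
      Subtype.val_injective.injOn).subset fun p hp => ?_
    have hdvd : ((p : ℕ) : ℤ) ∣ LinearMap.det (α.toLieHom : L →ₗ[ℤ] L) := by
      by_contra h
      exact hp (α.isUnit_toLocal p h)
    exact Nat.mem_primeFactors.mpr ⟨p.2, Int.natCast_dvd.mp hdvd,
      Int.natAbs_ne_zero.mpr (det_ne_zero_of_injEnd α)⟩⟩

end Global

/-! ## Hecke rings and series attached to a Lie algebra -/

section Series

variable (L : Type*) [LieRing L]

/-- The Hecke ring `R_L = R(Γ_L, Δ_L)`. -/
abbrev GlobalHecke : Type _ := HeckeAlg (GlobalMonoid L)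

/-- The local Hecke ring `R_{L_p} = R(Γ_{L_p}, Δ_{L_p})`. -/
abbrev LocalHecke (p : Nat.Primes) : Type _ := HeckeAlg (LocalMonoid L p)

/-- The Hecke ring `R̂_L = R(Γ̂_L, Δ̂_L)`. -/
abbrev AdelicHecke : Type _ := HeckeAlg (AdelicMonoid L)

/-- The formal Dirichlet series `D_L(s)`. -/
noncomputable def globalSeries : ArithmeticFunction (GlobalHecke L) :=
  Hecke.dirichletSeries (M := GlobalMonoid L) InjEnd.index

/-- The formal Dirichlet series `D̂_L(s)`. -/
noncomputable def adelicSeries : ArithmeticFunction (AdelicHecke L) :=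
  Hecke.dirichletSeries (M := AdelicMonoid L) AdelicMonoid.index

/-- The formal power series `P_{L_p}(X)`. -/
noncomputable def localSeries (p : Nat.Primes) : PowerSeries (LocalHecke L p) :=
  Hecke.powerSeries (M := LocalMonoid L p) InjEnd.index (p : ℕ)

end Series

/-! ## The Heisenberg Lie algebra -/

/-- The Heisenberg Lie algebra over `ℤ`: the elements are the triples `(a, b, c)` of integers, and
`[(a, b, c), (a', b', c')] = (0, 0, ab' - ba')`. -/
@[ext] structure Heisenberg where
  /-- First coordinate. -/
  a : ℤ
  /-- Second coordinate. -/
  b : ℤ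
  /-- Third (central) coordinate. -/
  c : ℤ

namespace Heisenberg

instance : Zero Heisenberg := ⟨⟨0, 0, 0⟩⟩
instance : Add Heisenberg := ⟨fun u v => ⟨u.a + v.a, u.b + v.b, u.c + v.c⟩⟩
instance : Neg Heisenberg := ⟨fun u => ⟨-u.a, -u.b, -u.c⟩⟩
instance : Bracket Heisenberg Heisenberg := ⟨fun u v => ⟨0, 0, u.a * v.b - u.b * v.a⟩⟩

@[simp] theorem zero_a : (0 : Heisenberg).a = 0 := rfl
@[simp] theorem zero_b : (0 : Heisenberg).b = 0 := rfl
@[simp] theorem zero_c : (0 : Heisenberg).c = 0 := rfl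
@[simp] theorem add_a (u v : Heisenberg) : (u + v).a = u.a + v.a := rfl
@[simp] theorem add_b (u v : Heisenberg) : (u + v).b = u.b + v.b := rfl
@[simp] theorem add_c (u v : Heisenberg) : (u + v).c = u.c + v.c := rfl
@[simp] theorem neg_a (u : Heisenberg) : (-u).a = -u.a := rfl
@[simp] theorem neg_b (u : Heisenberg) : (-u).b = -u.b := rfl
@[simp] theorem neg_c (u : Heisenberg) : (-u).c = -u.c := rfl

instance : AddCommGroup Heisenberg where
  add_assoc u v w := by ext <;> simp [add_assoc]
  zero_add u := by ext <;> simp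
  add_zero u := by ext <;> simp
  nsmul := nsmulRec
  zsmul := zsmulRec
  neg_add_cancel u := by ext <;> simp
  add_comm u v := by ext <;> simp [add_comm]

instance : LieRing Heisenberg where
  add_lie u v w := by ext <;> simp [Bracket.bracket]; ring
  lie_add u v w := by ext <;> simp [Bracket.bracket]; ring
  lie_self u := by ext <;> simp [Bracket.bracket]; ring
  leibniz_lie u v w := by ext <;> simp [Bracket.bracket]

@[simp] theorem lie_a (u v : Heisenberg) : ⁅u, v⁆.a = 0 := rfl
@[simp] theorem lie_b (u v : Heisenberg) : ⁅u, v⁆.b = 0 := rfl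
@[simp] theorem lie_c (u v : Heisenberg) : ⁅u, v⁆.c = u.a * v.b - u.b * v.a := rfl

/-- The underlying abelian group is `ℤ³`. -/
def equivProd : Heisenberg ≃ₗ[ℤ] ℤ × ℤ × ℤ :=
  AddEquiv.toIntLinearEquiv
    { toFun := fun u => (u.a, u.b, u.c)
      invFun := fun v => ⟨v.1, v.2.1, v.2.2⟩
      left_inv := fun _ => rfl
      right_inv := fun _ => rfl
      map_add' := fun _ _ => rfl }

instance : Module.Free ℤ Heisenberg := Module.Free.of_equiv equivProd.symm

instance : Module.Finite ℤ Heisenberg := Module.Finite.equiv equivProd.symm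

@[simp] theorem zsmul_a (n : ℤ) (u : Heisenberg) : (n • u).a = n * u.a :=
  congrArg (fun v : ℤ × ℤ × ℤ => v.1) (equivProd.map_smul n u)
@[simp] theorem zsmul_b (n : ℤ) (u : Heisenberg) : (n • u).b = n * u.b :=
  congrArg (fun v : ℤ × ℤ × ℤ => v.2.1) (equivProd.map_smul n u)
@[simp] theorem zsmul_c (n : ℤ) (u : Heisenberg) : (n • u).c = n * u.c :=
  congrArg (fun v : ℤ × ℤ × ℤ => v.2.2) (equivProd.map_smul n u)

attribute [local instance 2000] FreeLieAlgebra.instLieAlgebra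
attribute [local instance 2000] LieSubmodule.Quotient.lieQuotientLieAlgebra

/-- The free Lie algebra `F` on two generators over `ℤ`. -/
abbrev Free : Type := FreeLieAlgebra ℤ (Fin 2)

/-- The ideal `[F, [F, F]]`. -/
noncomputable abbrev freeIdeal : LieIdeal ℤ Free :=
  ⁅(⊤ : LieIdeal ℤ Free), ⁅(⊤ : LieIdeal ℤ Free), (⊤ : LieIdeal ℤ Free)⁆⁆

/-- The homomorphism from `F` sending the two generators to `(1, 0, 0)` and `(0, 1, 0)`. -/
noncomputable def ofFree : Free →ₗ⁅ℤ⁆ Heisenberg :=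
  FreeLieAlgebra.lift ℤ (fun i => if i = 0 then ⟨1, 0, 0⟩ else ⟨0, 1, 0⟩)

/-- The projection `F → F / [F, [F, F]]`. -/
noncomputable def proj : Free →ₗ⁅ℤ⁆ Free ⧸ freeIdeal :=
  { (LieSubmodule.Quotient.mk' freeIdeal).toLinearMap with
    map_lie' := fun {x y} => LieSubmodule.Quotient.mk_bracket freeIdeal x y }

theorem proj_eq_zero {u : Free} : proj u = 0 ↔ u ∈ freeIdeal :=
  LieSubmodule.Quotient.mk_eq_zero'

theorem lie_lie_quotient (u v w : Free ⧸ freeIdeal) : ⁅u, ⁅v, w⁆⁆ = 0 := by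
  obtain ⟨u, rfl⟩ : ∃ u', proj u' = u := LieSubmodule.Quotient.surjective_mk' _ u
  obtain ⟨v, rfl⟩ : ∃ v', proj v' = v := LieSubmodule.Quotient.surjective_mk' _ v
  obtain ⟨w, rfl⟩ : ∃ w', proj w' = w := LieSubmodule.Quotient.surjective_mk' _ w
  rw [← LieHom.map_lie, ← LieHom.map_lie, proj_eq_zero]
  exact LieSubmodule.lie_mem_lie trivial (LieSubmodule.lie_mem_lie trivial trivial)

/-- The homomorphism inverse to the one induced by `ofFree`. -/
noncomputable def toQuotient : Heisenberg →ₗ⁅ℤ⁆ Free ⧸ freeIdeal where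
  toFun u := u.a • proj (FreeLieAlgebra.of ℤ 0) + u.b • proj (FreeLieAlgebra.of ℤ 1)
    + u.c • ⁅proj (FreeLieAlgebra.of ℤ 0), proj (FreeLieAlgebra.of ℤ 1)⁆
  map_add' u v := by simp only [add_a, add_b, add_c]; module
  map_smul' n u := by simp only [zsmul_a, zsmul_b, zsmul_c, RingHom.id_apply]; module
  map_lie' {u v} := by
    have h : ⁅proj (FreeLieAlgebra.of ℤ 1), proj (FreeLieAlgebra.of ℤ 0)⁆
        = -⁅proj (FreeLieAlgebra.of ℤ 0), proj (FreeLieAlgebra.of ℤ 1)⁆ := (lie_skew _ _).symm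
    have h' : ∀ w : Free ⧸ freeIdeal,
        ⁅⁅proj (FreeLieAlgebra.of ℤ 0), proj (FreeLieAlgebra.of ℤ 1)⁆, w⁆ = 0 := fun w => by
      rw [← lie_skew, lie_lie_quotient, neg_zero]
    change ⁅u, v⁆.a • proj _ + ⁅u, v⁆.b • proj _ + ⁅u, v⁆.c • ⁅proj _, proj _⁆ =
      ⁅u.a • proj _ + u.b • proj _ + u.c • ⁅proj _, proj _⁆,
        v.a • proj _ + v.b • proj _ + v.c • ⁅proj _, proj _⁆⁆
    simp only [lie_a, lie_b, lie_c, lie_add, add_lie, lie_smul, smul_lie,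
      lie_self, lie_lie_quotient, h, h']
    module

theorem toQuotient_apply (u : Heisenberg) :
    toQuotient u = u.a • proj (FreeLieAlgebra.of ℤ 0) + u.b • proj (FreeLieAlgebra.of ℤ 1)
      + u.c • ⁅proj (FreeLieAlgebra.of ℤ 0), proj (FreeLieAlgebra.of ℤ 1)⁆ := rfl

/-- `Heisenberg` is the quotient of the free Lie algebra `F` on two generators over `ℤ` by
`[F, [F, F]]`: the canonical map is surjective, with kernel `[F, [F, F]]`. -/
theorem ofFree_surjective_and_ker :
    Function.Surjective ofFree ∧ ofFree.ker = freeIdeal := by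
  have h0 : ofFree (FreeLieAlgebra.of ℤ 0) = ⟨1, 0, 0⟩ := by
    rw [ofFree, FreeLieAlgebra.lift_of_apply, if_pos rfl]
  have h1 : ofFree (FreeLieAlgebra.of ℤ 1) = ⟨0, 1, 0⟩ := by
    rw [ofFree, FreeLieAlgebra.lift_of_apply, if_neg (by decide)]
  constructor
  · intro u
    obtain ⟨X, hX⟩ : ∃ X : Free, ofFree X = ⟨1, 0, 0⟩ := ⟨_, h0⟩
    obtain ⟨Y, hY⟩ : ∃ Y : Free, ofFree Y = ⟨0, 1, 0⟩ := ⟨_, h1⟩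
    refine ⟨u.a • X + u.b • Y + u.c • ⁅X, Y⁆, ?_⟩
    ext <;> simp [hX, hY]
  · apply le_antisymm
    · intro u hu
      have hcomp : toQuotient.comp ofFree = proj := by
        apply FreeLieAlgebra.hom_ext
        intro i
        rw [LieHom.comp_apply]
        fin_cases i
        · change toQuotient (ofFree (FreeLieAlgebra.of ℤ 0)) = proj (FreeLieAlgebra.of ℤ 0)
          rw [h0, toQuotient_apply]
          simp
        · change toQuotient (ofFree (FreeLieAlgebra.of ℤ 1)) = proj (FreeLieAlgebra.of ℤ 1)
          rw [h1, toQuotient_apply]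
          simp
      rw [← proj_eq_zero, ← hcomp, LieHom.comp_apply, LieHom.mem_ker.mp hu, map_zero]
    · rw [freeIdeal, LieSubmodule.lieIdeal_oper_eq_span, LieSubmodule.lieSpan_le]
      rintro _ ⟨u, ⟨v, hv⟩, rfl⟩
      have key : (ofFree v).a = 0 ∧ (ofFree v).b = 0 := by
        rw [← LieSubmodule.mem_toSubmodule, LieSubmodule.lieIdeal_oper_eq_linear_span'] at hv
        induction hv using Submodule.span_induction with
        | mem x hx =>
          obtain ⟨c, -, d, -, rfl⟩ := hx
          simp
        | zero => simp
        | add x y _ _ hx hy => simp [hx, hy]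
        | smul n x _ hx => simp [hx]
      refine LieHom.mem_ker.mpr ?_
      rw [LieHom.map_lie]
      ext <;> simp [key.1, key.2]

end Heisenberg

/-! ## Functoriality of abstract Hecke rings -/

/-! Everything is computed on cosets `Γa` instead of double cosets. Units have index 1, so the index
is constant on cosets and on double cosets, and `T(n)` is simply the characteristic function of the
cosets of index `n` (`coeff_sumOfIndex`). Two series agree as soon as they count the same cosets.

The Euler product for the adelic ring is then formal. A coset in the restricted product is a family
of local cosets, almost all trivial (`AdelicMonoid.mk_eq_mk_iff`), and its index is the product of
the local indices. For a set `S` of primes let `partialSeries` count the cosets that are trivial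
outside `S`. If `S` and `T` are disjoint, a coset supported on `S ∪ T` is uniquely a product of its
`S`-part and its `T`-part, and indices multiply; hence `partialSeries_mul`. The factor at `p` is the
series for `{p}` (`evalPrimePow_localSeries`), and the coefficient at `n` only sees primes dividing
`n`, because a local index is a power of `p` (`AdelicMonoid.partialSeries_apply_of_dvd`). The result
depends on a set of primes only, so the order of the factors is irrelevant even if the local rings
are not commutative.

Passing to the global ring requires that the diagonal map be bijective on cosets; functions on
cosets can then be pulled back (`HeckeAlg.pull`). Injectivity holds for every `L` that is free of
finite rank: a coset is determined by the image of `L`, and a sublattice of finite index is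
determined by its localizations. Surjectivity is where the Heisenberg algebra enters: an
endomorphism is a 2×2 matrix with two central entries, each local coset has a triangular
representative, and the Chinese remainder theorem yields an integral triangular matrix in all the
given local cosets at once (`map_toAdelicHom_surjective`). Surjectivity also transfers the
finiteness of the number of cosets of given index from `ℤ³` to the adelic monoid, and from there to
the local ones. -/

namespace Hecke

variable {M N : Type*} [Monoid M] [Monoid N]

theorem Coset.mk_eq_mk {a b : M} : Coset.mk a = Coset.mk b ↔ ∃ u : Mˣ, (u : M) * a = b :=
  ⟨fun h => Quotient.exact h, fun h => Quotient.sound h⟩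

/-- A representative of a coset. -/
noncomputable def Coset.out (c : Coset M) : M := Quotient.out c

@[simp] theorem Coset.mk_out (c : Coset M) : Coset.mk c.out = c := Quotient.out_eq c

theorem DoubleCoset.mk_eq_mk {a b : M} :
    DoubleCoset.mk a = DoubleCoset.mk b ↔ ∃ u v : Mˣ, (u : M) * a * (v : M) = b :=
  ⟨fun h => Quotient.exact h, fun h => Quotient.sound h⟩

/-- The map `Γa ↦ Γ'φ(a)` on cosets induced by a homomorphism `φ`. -/
def Coset.map (φ : M →* N) : Coset M → Coset N :=
  Quotient.lift (fun a => Coset.mk (φ a)) (by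
    rintro a b ⟨u, rfl⟩
    exact Quotient.sound ⟨Units.map φ u, by simp⟩)

@[simp] theorem Coset.map_mk (φ : M →* N) (a : M) :
    Coset.map φ (Coset.mk a) = Coset.mk (φ a) := rfl

theorem Coset.map_translate (φ : M →* N) (b : M) (c : Coset M) :
    Coset.map φ (c.translate b) = (Coset.map φ c).translate (φ b) := by
  obtain ⟨a, rfl⟩ := c.mk_surj
  simp

/-- The index of a coset, for a multiplicative index function. -/
def Coset.index (ν : M →* ℕ) : Coset M → ℕ :=
  Quotient.lift ν (by
    rintro a b ⟨u, rfl⟩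
    simp [Nat.isUnit_iff.mp (u.isUnit.map ν)])

@[simp] theorem Coset.index_mk (ν : M →* ℕ) (a : M) : Coset.index ν (Coset.mk a) = ν a := rfl

theorem map_unit_eq_one (ν : M →* ℕ) (u : Mˣ) : ν (u : M) = 1 :=
  Nat.isUnit_iff.mp (u.isUnit.map ν)

/-- The index of a double coset, for a multiplicative index function. -/
def DoubleCoset.index (ν : M →* ℕ) : DoubleCoset M → ℕ :=
  Quotient.lift ν (by
    rintro a b ⟨u, v, rfl⟩
    simp [map_unit_eq_one])

@[simp] theorem DoubleCoset.index_mk (ν : M →* ℕ) (a : M) :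
    DoubleCoset.index ν (DoubleCoset.mk a) = ν a := rfl

@[simp] theorem DoubleCoset.index_toDouble (ν : M →* ℕ) (c : Coset M) :
    DoubleCoset.index ν c.toDouble = c.index ν := by
  obtain ⟨a, rfl⟩ := c.mk_surj
  rfl

theorem DoubleCoset.mk_surj (D : DoubleCoset M) : ∃ a : M, DoubleCoset.mk a = D :=
  Quotient.exists_rep D

/-- The cosets in one double coset share its index, and every double coset of index `n` comes from a
coset of index `n`, so counting cosets by index settles both finiteness requirements. -/
theorem finitenessConditions_of_finite_cosets (ν : M →* ℕ) (hpos : ∀ a, 0 < ν a)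
    (hfin : ∀ n, 0 < n → {c : Coset M | c.index ν = n}.Finite) : FinitenessConditions ν := by
  refine ⟨fun D => ?_, hpos, fun n hn => ?_⟩
  · obtain ⟨a, rfl⟩ := D.mk_surj
    refine (hfin (ν a) (hpos a)).subset fun c hc => ?_
    have hc' : c.toDouble = DoubleCoset.mk a := hc
    change c.index ν = ν a
    rw [← DoubleCoset.index_toDouble, hc', DoubleCoset.index_mk]
  · refine ((hfin n hn).image Coset.toDouble).subset ?_
    rintro D ⟨a, rfl, ha⟩
    exact ⟨Coset.mk a, ha, rfl⟩

end Hecke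

/-! ### Coefficients of Hecke elements, and transport along monoid homomorphisms -/

namespace HeckeAlg

open Hecke

variable {M N : Type*} [Monoid M] [Monoid N]

theorem ext_coeff {x y : HeckeAlg M} (h : ∀ a, x.coeff a = y.coeff a) : x = y := by
  refine val_injective (Finsupp.ext fun c => ?_)
  obtain ⟨a, rfl⟩ := c.mk_surj
  exact h a

theorem coeff_zero (a : M) : (0 : HeckeAlg M).coeff a = 0 := by
  simp [coeff]

theorem coeff_sum {κ : Type*} (s : Finset κ) (f : κ → HeckeAlg M) (a : M) :
    (∑ i ∈ s, f i).coeff a = ∑ i ∈ s, (f i).coeff a := by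
  simp [coeff, Finsupp.finsetSum_apply]

open scoped Classical in
theorem coeff_single (D : Hecke.DoubleCoset M) (hD : {c : Coset M | c.toDouble = D}.Finite) (a : M) :
    (single D).coeff a = if Hecke.DoubleCoset.mk a = D then 1 else 0 := by
  change indicatorVal D (Coset.mk a) = _
  rw [indicatorVal, dif_pos hD, Finsupp.indicator_apply]
  simp

open scoped Classical in
-- Each coset lies in exactly one double coset, and the index does not change within it. From here
-- on double cosets can be forgotten.
theorem coeff_sumOfIndex (ν : M →* ℕ) (hν : FinitenessConditions ν) {n : ℕ} (hn : 0 < n) (a : M) :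
    (sumOfIndex ν n).coeff a = if ν a = n then 1 else 0 := by
  rw [sumOfIndex, finsum_mem_eq_finite_toFinset_sum _ (hν.2.2 n hn), coeff_sum]
  simp_rw [coeff_single _ (hν.1 _), Finset.sum_ite_eq]
  refine if_congr ?_ rfl rfl
  rw [Set.Finite.mem_toFinset]
  constructor
  · rintro ⟨b, hb, rfl⟩
    simpa using (congrArg (Hecke.DoubleCoset.index ν) hb).symm
  · exact fun h => ⟨a, rfl, h⟩

/-- If a homomorphism `φ` is injective on cosets and right translations by invertible elements of
`N` come from those by invertible elements of `M`, it induces an embedding of Hecke rings. -/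
noncomputable def push (φ : M →* N)
    (hφ : ∀ u : Nˣ, ∃ v : Mˣ, ∀ a : M, Coset.mk (φ a * u) = Coset.mk (φ (a * v))) :
    HeckeAlg M →+* HeckeAlg N :=
  -- The coset map intertwines right translation by `b` and by `φ b`; multiplicativity follows from
  -- this. Invariance of the image is what needs `hφ`.
  have key : ∀ (b : M) (x : Coset M →₀ ℤ), rightAct (φ b) (Finsupp.mapDomain (Coset.map φ) x) =
      Finsupp.mapDomain (Coset.map φ) (rightAct b x) := by
    intro b x
    have : (rightAct (φ b)).comp (Finsupp.mapDomain.addMonoidHom (Coset.map φ)) =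
        (Finsupp.mapDomain.addMonoidHom (Coset.map φ)).comp (rightAct b) :=
      addHom_ext_mk fun a => by simp [Finsupp.mapDomain_single]
    exact DFunLike.congr_fun this x
  let f (x : HeckeAlg M) : HeckeAlg N := ⟨Finsupp.mapDomain (Coset.map φ) (val x), fun u => by
    obtain ⟨v, hv⟩ := hφ u
    have : (rightAct (u : N)).comp (Finsupp.mapDomain.addMonoidHom (Coset.map φ)) =
        (Finsupp.mapDomain.addMonoidHom (Coset.map φ)).comp (rightAct (v : M)) :=
      addHom_ext_mk fun a => by simp [Finsupp.mapDomain_single, hv]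
    refine (DFunLike.congr_fun this (val x)).trans ?_
    change Finsupp.mapDomain (Coset.map φ) (rightAct (v : M) (val x)) = _
    rw [rightAct_val]⟩
  have hmul : ∀ (x : HeckeAlg M) (y : Coset M →₀ ℤ),
      Finsupp.mapDomain (Coset.map φ) (mulVal x y) =
        mulVal (f x) (Finsupp.mapDomain (Coset.map φ) y) := by
    intro x y
    have : (Finsupp.mapDomain.addMonoidHom (Coset.map φ)).comp (mulVal x) =
        (mulVal (f x)).comp (Finsupp.mapDomain.addMonoidHom (Coset.map φ)) :=
      addHom_ext_mk fun a => by
        simp only [AddMonoidHom.comp_apply, mulVal_single, one_smul,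
          Finsupp.mapDomain.addMonoidHom_apply, Finsupp.mapDomain_single, Coset.map_mk]
        exact (key a (val x)).symm
    exact DFunLike.congr_fun this y
  { toFun := f
    map_one' := val_injective <| by
      change Finsupp.mapDomain (Coset.map φ) (val 1) = val 1
      rw [val_one, val_one, Finsupp.mapDomain_single, Coset.map_mk, map_one]
    map_mul' := fun x y => val_injective (hmul x (val y))
    map_zero' := val_injective <| by
      change Finsupp.mapDomain (Coset.map φ) (val 0) = val 0
      simp
    map_add' := fun x y => val_injective <| by
      change Finsupp.mapDomain (Coset.map φ) (val (x + y)) =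
        Finsupp.mapDomain (Coset.map φ) (val x) + Finsupp.mapDomain (Coset.map φ) (val y)
      rw [map_add, Finsupp.mapDomain_add] }

section push

variable (φ : M →* N)
  (hφ : ∀ u : Nˣ, ∃ v : Mˣ, ∀ a : M, Coset.mk (φ a * u) = Coset.mk (φ (a * v)))

theorem val_push (x : HeckeAlg M) :
    val (push φ hφ x) = Finsupp.mapDomain (Coset.map φ) (val x) := rfl

theorem push_injective (hinj : Function.Injective (Coset.map φ)) :
    Function.Injective (push φ hφ) := fun _ _ h =>
  val_injective (Finsupp.mapDomain_injective hinj (congrArg val h))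

theorem coeff_push (hinj : Function.Injective (Coset.map φ)) (x : HeckeAlg M) {a : M} {b : N}
    (h : Coset.mk b = Coset.mk (φ a)) : (push φ hφ x).coeff b = x.coeff a := by
  rw [coeff, val_push, h, ← Coset.map_mk, Finsupp.mapDomain_apply hinj, coeff]

theorem coeff_push_of_notMem (x : HeckeAlg M) {b : N}
    (h : ∀ a : M, Coset.mk b ≠ Coset.mk (φ a)) : (push φ hφ x).coeff b = 0 := by
  rw [coeff, val_push, Finsupp.mapDomain_of_notMem_range]
  rintro ⟨c, hc⟩
  obtain ⟨a, rfl⟩ := c.mk_surj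
  exact h a hc.symm

/-- By `hφ`, a unit of `N` on the right of `φ a` can be replaced by the image of a unit of `M`.
Hence every coset inside the double coset of `φ a` comes from the double coset of `a`, and
injectivity makes the multiplicities equal to 1. -/
theorem push_T (hinj : Function.Injective (Coset.map φ))
    (hM : ∀ D : Hecke.DoubleCoset M, {c : Coset M | c.toDouble = D}.Finite)
    (hN : ∀ D : Hecke.DoubleCoset N, {c : Coset N | c.toDouble = D}.Finite) (a : M) :
    push φ hφ (T a) = T (φ a) := by
  classical
  refine ext_coeff fun b => ?_
  rw [T, T, coeff_single _ (hN _)]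
  by_cases h : ∃ a' : M, Coset.mk b = Coset.mk (φ a')
  · obtain ⟨a', h⟩ := h
    rw [coeff_push φ hφ hinj _ h, coeff_single _ (hM _)]
    refine if_congr ?_ rfl rfl
    rw [show Hecke.DoubleCoset.mk b = Hecke.DoubleCoset.mk (φ a') from congrArg Coset.toDouble h]
    constructor
    · rintro h
      obtain ⟨u, v, rfl⟩ := Hecke.DoubleCoset.mk_eq_mk.mp h
      exact Hecke.DoubleCoset.mk_eq_mk.mpr ⟨Units.map φ u, Units.map φ v, by simp⟩
    · rintro h
      obtain ⟨u, v, huv⟩ := Hecke.DoubleCoset.mk_eq_mk.mp h.symm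
      obtain ⟨w, hw⟩ := hφ v
      have h1 : Coset.mk (φ a') = Coset.mk (φ (a * w)) := by
        rw [← hw, ← huv, mul_assoc, Coset.mk_unit_mul]
      obtain ⟨t, ht⟩ := Coset.mk_eq_mk.mp (hinj (a₁ := Coset.mk a') (a₂ := Coset.mk (a * w)) h1)
      exact Hecke.DoubleCoset.mk_eq_mk.mpr ⟨t, w⁻¹, by simp [ht, mul_assoc]⟩
  · push Not at h
    rw [coeff_push_of_notMem φ hφ _ h, if_neg]
    intro hb
    obtain ⟨u, v, huv⟩ := Hecke.DoubleCoset.mk_eq_mk.mp hb.symm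
    obtain ⟨w, hw⟩ := hφ v
    refine h (a * w) ?_
    rw [← hw, ← huv, mul_assoc, Coset.mk_unit_mul]

end push

/-- If a homomorphism `φ` is bijective on cosets, pulling back functions on cosets along `φ` is an
embedding of Hecke rings. -/
noncomputable def pull (φ : M →* N) (hφ : Function.Bijective (Coset.map φ)) :
    HeckeAlg N →+* HeckeAlg M :=
  -- `F` intertwines the actions of `b` and `φ b`. Since `φ` maps units to units, `F.symm` preserves
  -- invariance; `F` itself need not, so the result is an embedding rather than an isomorphism.
  let F : (Coset M →₀ ℤ) ≃+ (Coset N →₀ ℤ) := Finsupp.domCongr (Equiv.ofBijective _ hφ)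
  have hF : ∀ (a : M) (n : ℤ),
      F (Finsupp.single (Coset.mk a) n) = Finsupp.single (Coset.mk (φ a)) n := by
    intro a n
    simp [F, Finsupp.domCongr_apply, Finsupp.equivMapDomain_single]
  have key : ∀ (b : M) (x : Coset M →₀ ℤ), rightAct (φ b) (F x) = F (rightAct b x) := by
    intro b x
    have : (rightAct (φ b)).comp F.toAddMonoidHom = F.toAddMonoidHom.comp (rightAct b) :=
      addHom_ext_mk fun a => by simp [hF]
    exact DFunLike.congr_fun this x
  let f (x : HeckeAlg N) : HeckeAlg M := ⟨F.symm (val x), fun u => F.injective <| by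
    rw [← key, F.apply_symm_apply]
    exact rightAct_val x (Units.map φ u)⟩
  have hf : ∀ x, F (val (f x)) = val x := fun x => F.apply_symm_apply (val x)
  have hmul : ∀ (x : HeckeAlg N) (y : Coset M →₀ ℤ), F (mulVal (f x) y) = mulVal x (F y) := by
    intro x y
    have : F.toAddMonoidHom.comp (mulVal (f x)) = (mulVal x).comp F.toAddMonoidHom :=
      addHom_ext_mk fun a => by simp [hF, ← key, hf]
    exact DFunLike.congr_fun this y
  { toFun := f
    map_one' := val_injective <| F.injective <| by
      rw [hf, val_one, val_one, hF, map_one]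
    map_mul' := fun x y => val_injective <| F.injective <| by
      rw [hf, val_mul, val_mul, hmul, hf]
    map_zero' := val_injective <| F.injective <| by
      rw [hf, map_zero, map_zero, map_zero]
    map_add' := fun x y => val_injective <| F.injective <| by
      rw [hf, map_add, map_add, map_add, hf, hf] }

section pull

variable (φ : M →* N) (hφ : Function.Bijective (Coset.map φ))

theorem coeff_pull (x : HeckeAlg N) (a : M) : (pull φ hφ x).coeff a = x.coeff (φ a) := rfl

theorem pull_injective : Function.Injective (pull φ hφ) := fun x y h => by
  refine ext_coeff fun b => ?_
  obtain ⟨c, hc⟩ := hφ.2 (Coset.mk b)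
  obtain ⟨a, rfl⟩ := c.mk_surj
  have := congrArg (fun z => coeff z a) h
  simp only [coeff_pull] at this
  rw [coeff, coeff, ← hc]
  exact this

end pull

end HeckeAlg

/-! ## Indices of images of endomorphisms -/

section Index

variable {R M : Type*} [CommRing R] [AddCommGroup M] [Module R M]

/-- `[M : fgM] = [M : fM] [fM : fgM]`, and the injective map `f` identifies the last index with `[M
: gM]`. -/
theorem LinearMap.index_range_comp {f g : M →ₗ[R] M} (hf : Function.Injective f) :
    (f ∘ₗ g).range.toAddSubgroup.index =
      f.range.toAddSubgroup.index * g.range.toAddSubgroup.index := by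
  have h : (f ∘ₗ g).range.toAddSubgroup = g.range.toAddSubgroup.map (f : M →+ M) := by
    ext x
    simp [LinearMap.mem_range]
  have h' : f.range.toAddSubgroup = (f : M →+ M).range := by
    ext x
    simp [LinearMap.mem_range]
  rw [h, h', AddSubgroup.index_map_of_injective _ hf, mul_comm]

theorem Ideal.index_span_singleton_mul [IsDomain R] {a : R} (ha : a ≠ 0) (b : R) :
    (Ideal.span {a * b}).toAddSubgroup.index =
      (Ideal.span {a}).toAddSubgroup.index * (Ideal.span {b}).toAddSubgroup.index := by
  have h : ∀ c : R, Ideal.span {c} = LinearMap.range (LinearMap.mulLeft R c) := by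
    intro c
    ext x
    simp [Ideal.mem_span_singleton', mul_comm c]
  rw [h, h, h, ← LinearMap.index_range_comp (f := LinearMap.mulLeft R a) (mul_right_injective₀ ha),
    LinearMap.mulLeft_mul]

theorem Ideal.index_span_singleton_prod [IsDomain R] {ι : Type*} (s : Finset ι) (a : ι → R)
    (ha : ∀ i, a i ≠ 0) :
    (Ideal.span {∏ i ∈ s, a i}).toAddSubgroup.index =
      ∏ i ∈ s, (Ideal.span {a i}).toAddSubgroup.index := by
  classical
  induction s using Finset.induction_on with
  | empty => simp
  | insert i s hi ih =>
    rw [Finset.prod_insert hi, Finset.prod_insert hi, Ideal.index_span_singleton_mul (ha i), ih]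

/-- The image of an injective endomorphism of a free module of finite rank over a PID has the same
index as the ideal generated by the determinant. -/
theorem LinearMap.index_range_eq_index_span_det [IsDomain R] [IsPrincipalIdealRing R]
    [Module.Free R M] [Module.Finite R M] {f : M →ₗ[R] M} (hf : Function.Injective f) :
    f.range.toAddSubgroup.index = (Ideal.span {LinearMap.det f}).toAddSubgroup.index := by
  classical
  let b := Module.Free.chooseBasis R M
  let N := f.range
  let e : M ≃ₗ[R] N := LinearEquiv.ofInjective f hf
  have h : Module.finrank R N = Module.finrank R M := e.symm.finrank_eq
  let a := Submodule.smithNormalFormCoeffs b h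
  let b' := Submodule.smithNormalFormTopBasis b h
  let ab := Submodule.smithNormalFormBotBasis b h
  have ab_eq := Submodule.smithNormalFormBotBasis_def b h
  -- `e'` matches the two Smith bases, so `g` is diagonal with the Smith coefficients. It has the
  -- same image as `f`, and its determinant differs from that of `f` by a unit.
  let e' : M ≃ₗ[R] N := b'.equiv ab (Equiv.refl _)
  let g : M →ₗ[R] M := N.subtype ∘ₗ (e' : M →ₗ[R] N)
  have hg : ∀ i, g (b' i) = a i • b' i := by
    intro i
    change ((b'.equiv ab (Equiv.refl _) (b' i) : N) : M) = _
    rw [b'.equiv_apply, Equiv.refl_apply]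
    exact ab_eq i
  have hassoc : Associated (LinearMap.det f) (LinearMap.det g) :=
    LinearMap.associated_det_comp_equiv N.subtype e e'
  have hdet : LinearMap.det g = ∏ i, a i := by
    rw [← LinearMap.det_toMatrix b', ← Matrix.det_diagonal]
    congr 1
    ext i j
    rw [LinearMap.toMatrix_apply, hg, map_smul, Module.Basis.repr_self, Finsupp.smul_single,
      smul_eq_mul, mul_one]
    by_cases h : i = j
    · rw [h, Matrix.diagonal_apply_eq, Finsupp.single_eq_same]
    · rw [Matrix.diagonal_apply_ne _ h, Finsupp.single_eq_of_ne h]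
  rw [Ideal.span_singleton_eq_span_singleton.mpr hassoc, hdet, Ideal.index_span_singleton_prod _ _
    (Submodule.smithNormalFormCoeffs_ne_zero b h)]
  change Nat.card (M ⧸ N) = ∏ i, Nat.card (R ⧸ Ideal.span {a i})
  rw [Nat.card_congr (Submodule.quotientEquivPiSpan N b h).toEquiv, Nat.card_pi]

end Index

/-- Up to a unit `x` is `p ^ v`, whose ideal is the kernel of the surjection onto `ZMod (p ^ v)`. -/
theorem PadicInt.index_span_singleton {p : ℕ} [Fact p.Prime] {x : ℤ_[p]} (hx : x ≠ 0) :
    (Ideal.span {x}).toAddSubgroup.index = p ^ x.valuation := by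
  have h : Ideal.span {x} = Ideal.span {(p : ℤ_[p]) ^ x.valuation} := by
    rw [Ideal.span_singleton_eq_span_singleton]
    conv_lhs => rw [PadicInt.unitCoeff_spec hx]
    exact associated_unit_mul_left _ _ (Units.isUnit _)
  rw [h, ← PadicInt.ker_toZModPow]
  have : (RingHom.ker (PadicInt.toZModPow (p := p) x.valuation)).toAddSubgroup =
      (PadicInt.toZModPow (p := p) x.valuation).toAddMonoidHom.ker := by
    ext; simp [RingHom.mem_ker]
  rw [this, AddSubgroup.index_ker]
  have hsurj : (PadicInt.toZModPow (p := p) x.valuation).toAddMonoidHom.range = ⊤ :=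
    AddMonoidHom.range_eq_top.mpr (ZMod.ringHom_surjective _)
  rw [hsurj, Nat.card_congr AddSubgroup.topEquiv.toEquiv, Nat.card_zmod]

theorem Int.index_span_singleton (n : ℤ) :
    (Ideal.span {n}).toAddSubgroup.index = n.natAbs := by
  rw [← Int.span_natAbs]
  exact Int.card_ideal_quot n.natAbs

/-- The coordinates outside `s` impose no condition, so the subgroup is pulled back from the finite
product over `s`, where the quotient is a product of quotients. -/
theorem AddSubgroup.index_pi_of_eq_top {ι : Type*} {G : ι → Type*} [∀ i, AddCommGroup (G i)]
    (H : ∀ i, AddSubgroup (G i)) (s : Finset ι) (hs : ∀ i ∉ s, H i = ⊤) :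
    (AddSubgroup.pi Set.univ H).index = ∏ i ∈ s, (H i).index := by
  classical
  let f : (∀ i, G i) →+ ∀ i : s, G i :=
    { toFun := fun x i => x i
      map_zero' := rfl
      map_add' := fun _ _ => rfl }
  have hf : Function.Surjective f := fun y =>
    ⟨fun i => if h : i ∈ s then y ⟨i, h⟩ else 0, by ext i; simp [f]⟩
  have h : AddSubgroup.pi Set.univ H =
      (AddSubgroup.pi Set.univ fun i : s => H i).comap f := by
    ext x
    simp only [AddSubgroup.mem_pi, AddSubgroup.mem_comap, Set.mem_univ, forall_true_left]
    refine ⟨fun hx i => hx i, fun hx i => ?_⟩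
    by_cases hi : i ∈ s
    · exact hx ⟨i, hi⟩
    · simp [hs i hi]
  rw [h, AddSubgroup.index_comap_of_surjective _ hf]
  have hcard : (AddSubgroup.pi Set.univ fun i : s => H i).index = ∏ i : s, (H i).index := by
    simp_rw [AddSubgroup.index, ← Nat.card_pi]
    refine Nat.card_congr
      ((Quotient.congrRight fun x y => ?_).trans (Setoid.piQuotientEquiv _).symm)
    rw [QuotientAddGroup.leftRel_pi]
  rw [hcard]
  exact Finset.prod_coe_sort s fun i => (H i).index

/-! ### Multiplicativity of the index; cosets as images -/

namespace InjEnd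

variable {R L : Type*} [CommRing R] [LieRing L] [LieAlgebra R L]

theorem index_one : (1 : InjEnd R L).index = 1 := by
  rw [index, AddSubgroup.index_eq_one, image]
  exact (AddSubgroup.eq_top_iff' _).mpr fun x => ⟨x, rfl⟩

theorem index_mul (α β : InjEnd R L) : (α * β).index = α.index * β.index := by
  rw [mul_comm]
  exact LinearMap.index_range_comp (f := (β.toLieHom : L →ₗ[R] L)) β.injective

variable (R L) in
/-- The index as a homomorphism of monoids. -/
noncomputable def indexHom : InjEnd R L →* ℕ where
  toFun := index
  map_one' := index_one
  map_mul' := index_mul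

@[simp] theorem coe_indexHom : ⇑(indexHom R L) = index := rfl

theorem isUnit_iff_image_eq_top (α : InjEnd R L) : IsUnit α ↔ α.image = ⊤ := by
  rw [isUnit_iff, Function.Bijective, and_iff_right α.injective, AddSubgroup.eq_top_iff']
  rfl

theorem isUnit_iff_index_eq_one (α : InjEnd R L) : IsUnit α ↔ α.index = 1 := by
  rw [isUnit_iff_image_eq_top, index, AddSubgroup.index_eq_one]

/-- A coset `Γα` is determined by the image of `α`. -/
theorem mk_eq_mk_iff {α β : InjEnd R L} :
    Hecke.Coset.mk α = Hecke.Coset.mk β ↔ α.image = β.image := by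
  rw [Hecke.Coset.mk_eq_mk]
  constructor
  · rintro ⟨u, rfl⟩
    ext x
    constructor
    · rintro ⟨y, rfl⟩
      refine ⟨(u⁻¹).val.toLieHom y, ?_⟩
      change ((u⁻¹).val * (u.val * α)).toLieHom y = α.toLieHom y
      rw [← mul_assoc, Units.inv_mul, one_mul]
    · rintro ⟨y, rfl⟩
      exact ⟨u.val.toLieHom y, rfl⟩
  · intro h
    have h1 : ∀ x, ∃ y, α.toLieHom y = β.toLieHom x := fun x => by
      have : β.toLieHom x ∈ α.image := h ▸ ⟨x, rfl⟩
      exact this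
    have h2 : ∀ x, ∃ y, β.toLieHom y = α.toLieHom x := fun x => by
      have : α.toLieHom x ∈ β.image := h ▸ ⟨x, rfl⟩
      exact this
    -- `f` is `β` followed by the inverse of `α` on the common image; injectivity of `α` makes it a
    -- Lie homomorphism.
    choose f hf using h1
    let u : InjEnd R L := ⟨
      { toFun := f
        map_add' := fun x y => α.injective (by simp [hf])
        map_smul' := fun r x => α.injective (by simp [hf])
        map_lie' := fun {x y} => α.injective (by simp [hf]) }, fun x y hxy => by
        apply β.injective
        rw [← hf, ← hf]
        exact congrArg α.toLieHom hxy⟩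
    have hu : IsUnit u := (isUnit_iff u).mpr ⟨u.injective, fun x => by
      obtain ⟨y, hy⟩ := h2 x
      exact ⟨y, α.injective ((hf y).trans hy)⟩⟩
    obtain ⟨v, hv⟩ := hu
    refine ⟨v, ext fun x => ?_⟩
    rw [hv, mul_apply]
    exact hf x

end InjEnd

/-- A group in which the multiples of any positive integer form a subgroup of finite index has
finitely many subgroups of any given positive index. -/
theorem AddSubgroup.finite_setOf_index_eq {G : Type*} [AddCommGroup G]
    (hG : ∀ n : ℕ, 0 < n → (nsmulAddMonoidHom (α := G) n).range.index ≠ 0) {n : ℕ} (hn : 0 < n) :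
    {H : AddSubgroup G | H.index = n}.Finite := by
  -- A subgroup of index `n` contains `nG`, so it is the preimage of a subgroup of the finite group
  -- `G / nG`.
  let K := (nsmulAddMonoidHom (α := G) n).range
  have hK : Finite (G ⧸ K) := AddSubgroup.index_ne_zero_iff_finite.mp (hG n hn)
  have : Finite (AddSubgroup (G ⧸ K)) := inferInstance
  refine (Set.finite_range (fun S : AddSubgroup (G ⧸ K) => S.comap (QuotientAddGroup.mk' K))).subset
    fun H hH => ?_
  refine ⟨H.map (QuotientAddGroup.mk' K), ?_⟩
  refine AddSubgroup.comap_map_eq_self ?_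
  rw [QuotientAddGroup.ker_mk']
  rintro _ ⟨x, rfl⟩
  have hH' : H.index = n := hH
  change n • x ∈ H
  rw [← hH']
  exact H.nsmul_index_mem x

/-! ### Units, cosets and indices in the adelic monoid; comparison with the global one -/

section Adelic

variable {L : Type*} [LieRing L]

namespace AdelicMonoid

theorem isUnit_iff {α : AdelicMonoid L} : IsUnit α ↔ ∀ p, IsUnit (α.1 p) := by
  constructor
  · intro h p
    exact h.map ((Pi.evalMonoidHom _ p).comp (AdelicMonoid L).subtype)
  · intro h
    choose u hu using h
    refine ⟨⟨α, ⟨fun p => (u p)⁻¹.val, ?_⟩, ?_, ?_⟩, rfl⟩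
    · refine Set.finite_empty.subset fun p hp => hp (Units.isUnit _)
    · ext p : 2
      change α.1 p * (u p)⁻¹.val = 1
      rw [← hu, Units.mul_inv]
    · ext p : 2
      change (u p)⁻¹.val * α.1 p = 1
      rw [← hu, Units.inv_mul]

/-- Local units chosen independently at all primes always assemble to a unit of the restricted
product, so no finiteness has to be checked. -/
theorem mk_eq_mk_iff {α β : AdelicMonoid L} :
    Hecke.Coset.mk α = Hecke.Coset.mk β ↔
      ∀ p, Hecke.Coset.mk (α.1 p) = Hecke.Coset.mk (β.1 p) := by
  constructor
  · intro h p
    exact congrArg (Hecke.Coset.map ((Pi.evalMonoidHom _ p).comp (AdelicMonoid L).subtype)) h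
  · intro h
    choose u hu using fun p => Hecke.Coset.mk_eq_mk.mp (h p)
    let v : AdelicMonoid L := ⟨fun p => (u p).val,
      Set.finite_empty.subset fun p hp => hp (Units.isUnit _)⟩
    have hv : IsUnit v := isUnit_iff.mpr fun p => Units.isUnit (u p)
    exact Hecke.Coset.mk_eq_mk.mpr ⟨hv.unit, Subtype.ext (funext hu)⟩

theorem index_eq_prod (α : AdelicMonoid L) (s : Finset Nat.Primes)
    (hs : ∀ p ∉ s, IsUnit (α.1 p)) : index α = ∏ p ∈ s, (α.1 p).index :=
  AddSubgroup.index_pi_of_eq_top _ s fun p hp => (InjEnd.isUnit_iff_image_eq_top _).mp (hs p hp)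

variable (L) in
/-- The index as a homomorphism of monoids. -/
noncomputable def indexHom : AdelicMonoid L →* ℕ where
  toFun := index
  map_one' := by
    rw [index_eq_prod 1 ∅ fun p _ => isUnit_one, Finset.prod_empty]
  map_mul' := fun α β => by
    classical
    let s := (show Set.Finite {p | ¬ IsUnit (α.1 p)} from α.2).toFinset
    let t := (show Set.Finite {p | ¬ IsUnit (β.1 p)} from β.2).toFinset
    have hα : ∀ p ∉ s ∪ t, IsUnit (α.1 p) := fun p hp => by
      by_contra h
      exact hp (Finset.mem_union_left _ (by simpa [s] using h))
    have hβ : ∀ p ∉ s ∪ t, IsUnit (β.1 p) := fun p hp => by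
      by_contra h
      exact hp (Finset.mem_union_right _ (by simpa [t] using h))
    rw [index_eq_prod α _ hα, index_eq_prod β _ hβ,
      index_eq_prod (α * β) (s ∪ t) fun p hp => (hα p hp).mul (hβ p hp), ← Finset.prod_mul_distrib]
    exact Finset.prod_congr rfl fun p _ => InjEnd.index_mul _ _

@[simp] theorem coe_indexHom : ⇑(indexHom L) = index := rfl

end AdelicMonoid

theorem LocalMonoid.toAdelic_apply_same (p : Nat.Primes) (α : LocalMonoid L p) :
    (LocalMonoid.toAdelic p α).1 p = α := by
  classical
  exact Pi.mulSingle_eq_same (M := fun q : Nat.Primes => LocalMonoid L q) p α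

theorem LocalMonoid.toAdelic_apply_of_ne {p q : Nat.Primes} (h : q ≠ p) (α : LocalMonoid L p) :
    (LocalMonoid.toAdelic p α).1 q = 1 := by
  classical
  exact Pi.mulSingle_eq_of_ne (M := fun q : Nat.Primes => LocalMonoid L q) h α

theorem LocalMonoid.index_toAdelic (p : Nat.Primes) (α : LocalMonoid L p) :
    AdelicMonoid.index (LocalMonoid.toAdelic p α) = α.index := by
  rw [AdelicMonoid.index_eq_prod _ {p}, Finset.prod_singleton, toAdelic_apply_same]
  intro q hq
  rw [toAdelic_apply_of_ne (by simpa using hq)]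
  exact isUnit_one

variable [Module.Free ℤ L] [Module.Finite ℤ L]

theorem LocalMonoid.det_ne_zero (p : Nat.Primes) (α : LocalMonoid L p) :
    LinearMap.det (α.toLieHom : LocalLie L p →ₗ[ℤ_[(p : ℕ)]] LocalLie L p) ≠ 0 := fun h =>
  LinearMap.det_eq_zero_iff_ker_ne_bot.mp h (LinearMap.ker_eq_bot.mpr α.injective)

theorem LocalMonoid.index_eq (p : Nat.Primes) (α : LocalMonoid L p) :
    α.index = (p : ℕ) ^
      (LinearMap.det (α.toLieHom : LocalLie L p →ₗ[ℤ_[(p : ℕ)]] LocalLie L p)).valuation := by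
  rw [← PadicInt.index_span_singleton (LocalMonoid.det_ne_zero p α),
    ← LinearMap.index_range_eq_index_span_det α.injective]
  rfl

theorem GlobalMonoid.index_eq (α : GlobalMonoid L) :
    α.index = (LinearMap.det (α.toLieHom : L →ₗ[ℤ] L)).natAbs := by
  rw [← Int.index_span_singleton, ← LinearMap.index_range_eq_index_span_det α.injective]
  rfl

theorem GlobalMonoid.index_pos (α : GlobalMonoid L) : 0 < α.index := by
  rw [GlobalMonoid.index_eq]
  exact Int.natAbs_pos.mpr (det_ne_zero_of_injEnd α)

/-- Both indices are read off from the determinant, which is compatible with base change. -/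
theorem GlobalMonoid.index_toLocal (α : GlobalMonoid L) (p : Nat.Primes) :
    (α.toLocal p).index = (p : ℕ) ^ α.index.factorization p := by
  rw [LocalMonoid.index_eq, GlobalMonoid.index_eq]
  congr 1
  have : LinearMap.det ((α.toLocal p).toLieHom :
      LocalLie L p →ₗ[ℤ_[(p : ℕ)]] LocalLie L p) =
      ((LinearMap.det (α.toLieHom : L →ₗ[ℤ] L) : ℤ) : ℤ_[(p : ℕ)]) :=
    (LinearMap.det_baseChange _).trans (by simp)
  rw [this, Nat.factorization_def _ p.2]
  have h := PadicInt.valuation_coe ((LinearMap.det (α.toLieHom : L →ₗ[ℤ] L) : ℤ) : ℤ_[(p : ℕ)])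
  rw [PadicInt.coe_intCast, Padic.valuation_intCast] at h
  exact_mod_cast h.symm

theorem GlobalMonoid.index_toAdelic (α : GlobalMonoid L) : AdelicMonoid.index α.toAdelic = α.index := by
  have hs : ∀ p ∉ α.index.primeFactors.subtype Nat.Prime, IsUnit (α.toAdelic.1 p) := by
    intro p hp
    refine (InjEnd.isUnit_iff_index_eq_one _).mpr ((α.index_toLocal p).trans ?_)
    rw [Nat.factorization_eq_zero_of_not_dvd, pow_zero]
    intro h
    exact hp (Finset.mem_subtype.mpr (Nat.mem_primeFactors.mpr ⟨p.2, h, α.index_pos.ne'⟩))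
  rw [AdelicMonoid.index_eq_prod _ _ hs]
  conv_rhs => rw [← Nat.prod_factorization_pow_eq_self α.index_pos.ne']
  rw [Finsupp.prod, Nat.support_factorization]
  refine (Finset.prod_congr rfl fun p _ => α.index_toLocal p).trans ?_
  exact Finset.prod_subtype_of_mem (p := Nat.Prime)
    (fun q : ℕ => q ^ α.index.factorization q) fun q hq => (Nat.mem_primeFactors.mp hq).1

/-- The natural map `Δ_L → Δ̂_L` as a homomorphism of monoids. -/
noncomputable def GlobalMonoid.toAdelicHom (L : Type*) [LieRing L] [Module.Free ℤ L]
    [Module.Finite ℤ L] : GlobalMonoid L →* AdelicMonoid L where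
  toFun := GlobalMonoid.toAdelic
  map_one' := by
    ext p x
    exact LinearMap.congr_fun (LinearMap.baseChange_id (R := ℤ) (A := ℤ_[(p : ℕ)]) (M := L)) x
  map_mul' := fun α β => by
    ext p x
    exact LinearMap.congr_fun (LinearMap.baseChange_comp (A := ℤ_[(p : ℕ)])
      (α.toLieHom : L →ₗ[ℤ] L) (β.toLieHom : L →ₗ[ℤ] L)) x

/-- A coset is determined by its image, and a free abelian group of finite rank has finitely many
subgroups of index `n`. -/
theorem GlobalMonoid.finite_cosets_of_index {n : ℕ} (hn : 0 < n) :
    {c : Hecke.Coset (GlobalMonoid L) | c.index (InjEnd.indexHom ℤ L) = n}.Finite := by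
  have hfin : {H : AddSubgroup L | H.index = n}.Finite :=
    AddSubgroup.finite_setOf_index_eq (fun m hm => by
      rw [AddSubgroup.index_range_nsmul]
      exact pow_ne_zero _ hm.ne') hn
  let f : Hecke.Coset (GlobalMonoid L) → AddSubgroup L :=
    Quotient.lift InjEnd.image fun α β h => InjEnd.mk_eq_mk_iff.mp (Quotient.sound h)
  have hf : Function.Injective f := by
    intro c d h
    obtain ⟨α, rfl⟩ := c.mk_surj
    obtain ⟨β, rfl⟩ := d.mk_surj
    exact InjEnd.mk_eq_mk_iff.mpr h
  refine (hfin.preimage hf.injOn).subset fun c hc => ?_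
  obtain ⟨α, rfl⟩ := c.mk_surj
  exact hc

end Adelic

/-! ## Local-global principles -/

theorem Int.dvd_of_forall_padicInt_dvd {n m : ℤ}
    (h : ∀ p : Nat.Primes, (n : ℤ_[(p : ℕ)]) ∣ (m : ℤ_[(p : ℕ)])) : n ∣ m := by
  rw [← Int.natAbs_dvd_natAbs, Nat.dvd_iff_prime_pow_dvd_dvd]
  intro p k hp hk
  have : Fact p.Prime := ⟨hp⟩
  rw [← Int.natCast_dvd, Nat.cast_pow, ← PadicInt.pow_p_dvd_int_iff] at hk ⊢
  exact hk.trans (h ⟨p, hp⟩)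

/-- `ℤ` is dense in `∏ₚ ℤ_p`. -/
theorem PadicInt.exists_int_dvd_sub {d : ℤ} (hd : d ≠ 0) (x : ∀ p : Nat.Primes, ℤ_[(p : ℕ)]) :
    ∃ m : ℤ, ∀ p : Nat.Primes, (d : ℤ_[(p : ℕ)]) ∣ (m : ℤ_[(p : ℕ)]) - x p := by
  classical
  -- Outside `s` the integer `d` is a local unit and nothing is required; on `s` the Chinese
  -- remainder theorem applies to approximations of `x p` modulo `p ^ v p`.
  let s : Finset Nat.Primes := d.natAbs.primeFactors.subtype Nat.Prime
  let v : Nat.Primes → ℕ := fun p => (d : ℤ_[(p : ℕ)]).valuation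
  have hco : Set.Pairwise (s : Set Nat.Primes)
      (Function.onFun Nat.Coprime fun p : Nat.Primes => (p : ℕ) ^ v p) := fun p _ q _ hpq =>
    Nat.Coprime.pow _ _ ((Nat.coprime_primes p.2 q.2).mpr fun h => hpq (Subtype.ext h))
  obtain ⟨m, hm⟩ := Nat.chineseRemainderOfFinset (fun p : Nat.Primes => (x p).appr (v p))
    (fun p : Nat.Primes => (p : ℕ) ^ v p) s (fun p _ => pow_ne_zero _ p.2.ne_zero) hco
  refine ⟨m, fun p => ?_⟩
  have hd' : (d : ℤ_[(p : ℕ)]) ≠ 0 := by exact_mod_cast hd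
  rw [PadicInt.unitCoeff_spec hd', IsUnit.mul_left_dvd (Units.isUnit _)]
  change (p : ℤ_[(p : ℕ)]) ^ v p ∣ _
  by_cases hp : p ∈ s
  · have h1 : (p : ℤ_[(p : ℕ)]) ^ v p ∣ x p - (x p).appr (v p) :=
      Ideal.mem_span_singleton.mp (PadicInt.appr_spec (v p) (x p))
    have h2 : (p : ℤ_[(p : ℕ)]) ^ v p ∣ (m : ℤ_[(p : ℕ)]) - ((x p).appr (v p) : ℕ) := by
      have := (Nat.modEq_iff_dvd.mp (hm p hp).symm)
      have h3 := (PadicInt.pow_p_dvd_int_iff (p := p) (v p) _).mpr (by exact_mod_cast this)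
      simpa using h3
    have := dvd_sub h2 h1
    simpa using this
  · have : v p = 0 := by
      have h : ¬ ((p : ℕ) : ℤ) ∣ d := fun h => hp (Finset.mem_subtype.mpr
        (Nat.mem_primeFactors.mpr ⟨p.2, Int.natCast_dvd.mp h, Int.natAbs_ne_zero.mpr hd⟩))
      by_contra hv
      refine h ?_
      have h1 : (p : ℤ_[(p : ℕ)]) ^ 1 ∣ (d : ℤ_[(p : ℕ)]) := by
        rw [PadicInt.unitCoeff_spec hd']
        exact Dvd.dvd.mul_left (pow_dvd_pow _ (Nat.one_le_iff_ne_zero.mpr hv)) _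
      simpa using (PadicInt.pow_p_dvd_int_iff (p := p) 1 d).mp h1
    rw [this, pow_zero]
    exact one_dvd _

section

variable {L : Type*} [LieRing L] [Module.Free ℤ L] [Module.Finite ℤ L]

/-- With `n` the index, `n • y` is the image of some `w`. Local membership and injectivity show that
`n` divides the coordinates of `w` in every `ℤ_p`, hence in `ℤ`. Thus `w = n • z`, and cancelling
`n` shows that `z` maps to `y`. -/
theorem GlobalMonoid.mem_image_of_forall_local (γ : GlobalMonoid L) {y : L}
    (h : ∀ p : Nat.Primes, (1 : ℤ_[(p : ℕ)]) ⊗ₜ[ℤ] y ∈ (γ.toLocal p).image) : y ∈ γ.image := by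
  have hn : γ.index • y ∈ γ.image := γ.image.nsmul_index_mem y
  set n := γ.index with hn_def
  have hn0 : n ≠ 0 := γ.index_pos.ne'
  obtain ⟨w, hw⟩ := hn
  let b := Module.Free.chooseBasis ℤ L
  have hdvd : ∀ i, (n : ℤ) ∣ b.repr w i := fun i => by
    refine Int.dvd_of_forall_padicInt_dvd fun p => ?_
    obtain ⟨w', hw'⟩ := h p
    have h1 : (1 : ℤ_[(p : ℕ)]) ⊗ₜ[ℤ] w = n • w' := by
      apply (γ.toLocal p).injective
      rw [map_nsmul]
      refine (LinearMap.baseChange_tmul (A := ℤ_[(p : ℕ)]) (γ.toLieHom : L →ₗ[ℤ] L) 1 w).trans ?_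
      rw [hw]
      refine (TensorProduct.tmul_smul _ _ _).trans ?_
      exact congrArg (n • ·) hw'.symm
    have h2 := congrArg (fun z => (b.baseChange ℤ_[(p : ℕ)]).repr z i) h1
    rw [← Nat.cast_smul_eq_nsmul ℤ_[(p : ℕ)]] at h2
    simp only [Module.Basis.baseChange_repr_tmul, map_smul, Finsupp.smul_apply, smul_eq_mul] at h2
    refine ⟨(b.baseChange ℤ_[(p : ℕ)]).repr w' i, ?_⟩
    simpa using h2
  choose c hc using hdvd
  let z : L := b.equivFun.symm c
  have hz : w = n • z := by
    apply b.equivFun.injective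
    rw [map_nsmul, LinearEquiv.apply_symm_apply]
    ext i
    simp [hc]
  refine ⟨z, ?_⟩
  have hn0' : (n : ℤ) ≠ 0 := by exact_mod_cast hn0
  refine smul_right_injective L hn0' ?_
  change (n : ℤ) • γ.toLieHom z = (n : ℤ) • y
  rw [natCast_zsmul, natCast_zsmul, ← map_nsmul, ← hz]
  exact hw

theorem GlobalMonoid.map_toAdelicHom_injective :
    Function.Injective (Hecke.Coset.map (GlobalMonoid.toAdelicHom L)) := by
  intro c d h
  obtain ⟨β, rfl⟩ := c.mk_surj
  obtain ⟨γ, rfl⟩ := d.mk_surj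
  have h' : ∀ p, (β.toLocal p).image = (γ.toLocal p).image := fun p =>
    InjEnd.mk_eq_mk_iff.mp (AdelicMonoid.mk_eq_mk_iff.mp h p)
  have key : ∀ α δ : GlobalMonoid L, (∀ p, (α.toLocal p).image = (δ.toLocal p).image) →
      α.image ≤ δ.image := by
    rintro α δ h _ ⟨x, rfl⟩
    refine δ.mem_image_of_forall_local fun p => ?_
    rw [← h p]
    exact ⟨1 ⊗ₜ x, LinearMap.baseChange_tmul (A := ℤ_[(p : ℕ)]) (α.toLieHom : L →ₗ[ℤ] L) 1 x⟩
  exact InjEnd.mk_eq_mk_iff.mpr (le_antisymm (key _ _ h') (key _ _ fun p => (h' p).symm))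

end

/-! ## Endomorphisms of the Heisenberg Lie algebra in coordinates -/

namespace Heisenberg

section Coordinates

variable (R : Type*) [CommRing R]

/-- The coordinates on `R ⊗ Heisenberg`. -/
noncomputable def coord : R ⊗[ℤ] Heisenberg ≃ₗ[R] R × R × R :=
  (LinearEquiv.baseChange ℤ R Heisenberg (ℤ × ℤ × ℤ) equivProd) ≪≫ₗ
    (TensorProduct.prodRight ℤ R R ℤ (ℤ × ℤ)) ≪≫ₗ
    LinearEquiv.prodCongr (TensorProduct.AlgebraTensorModule.rid ℤ R R)
      ((TensorProduct.prodRight ℤ R R ℤ ℤ) ≪≫ₗ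
        LinearEquiv.prodCongr (TensorProduct.AlgebraTensorModule.rid ℤ R R)
          (TensorProduct.AlgebraTensorModule.rid ℤ R R))

theorem coord_tmul (r : R) (u : Heisenberg) :
    coord R (r ⊗ₜ u) = (r * u.a, r * u.b, r * u.c) := by
  have : coord R (r ⊗ₜ u) = (u.a • r, u.b • r, u.c • r) := rfl
  rw [this]
  simp [mul_comm]

variable {R}

theorem coord_lie (x y : R ⊗[ℤ] Heisenberg) : coord R ⁅x, y⁆ =
    (0, 0, (coord R x).1 * (coord R y).2.1 - (coord R x).2.1 * (coord R y).1) := by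
  induction x using TensorProduct.induction_on with
  | zero =>
    rw [zero_lie, map_zero]
    ext <;> simp
  | add x x' hx hx' =>
    rw [add_lie, map_add, hx, hx', map_add]
    ext <;> simp
    ring
  | tmul r u =>
    induction y using TensorProduct.induction_on with
    | zero =>
      rw [map_zero]
      refine (congrArg (coord R) (lie_zero (L := R ⊗[ℤ] Heisenberg) (r ⊗ₜ[ℤ] u))).trans ?_
      ext <;> simp
    | add y y' hy hy' =>
      rw [LieRing.lie_add, map_add, hy, hy', map_add]
      ext <;> simp
      ring
    | tmul t v =>
      rw [LieAlgebra.ExtendScalars.bracket_tmul]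
      simp only [coord_tmul]
      ext <;> simp
      ring

/-- The endomorphism of `R ⊗ Heisenberg` which sends the basis vectors `x, y` to `(a, b, r)` and
`(c, d, s)`, in coordinates. -/
noncomputable def endOfEntries (a b c d r s : R) : R ⊗[ℤ] Heisenberg →ₗ⁅R⁆ R ⊗[ℤ] Heisenberg where
  toFun x := (coord R).symm ((coord R x).1 * a + (coord R x).2.1 * c,
    (coord R x).1 * b + (coord R x).2.1 * d,
    -- The central basis vector is the bracket of the other two, so it must be multiplied by the
    -- determinant.
    (coord R x).1 * r + (coord R x).2.1 * s + (coord R x).2.2 * (a * d - b * c))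
  map_add' x y := by
    apply (coord R).injective
    simp only [map_add, LinearEquiv.apply_symm_apply]
    ext <;> simp <;> ring
  map_smul' t x := by
    apply (coord R).injective
    simp only [map_smul, LinearEquiv.apply_symm_apply, RingHom.id_apply]
    ext <;> simp <;> ring
  map_lie' {x y} := by
    apply (coord R).injective
    simp only [coord_lie, LinearEquiv.apply_symm_apply]
    ext <;> simp
    ring

theorem coord_endOfEntries (a b c d r s : R) (x : R ⊗[ℤ] Heisenberg) :
    coord R (endOfEntries a b c d r s x) = ((coord R x).1 * a + (coord R x).2.1 * c,
    (coord R x).1 * b + (coord R x).2.1 * d,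
    (coord R x).1 * r + (coord R x).2.1 * s + (coord R x).2.2 * (a * d - b * c)) :=
  (coord R).apply_symm_apply _

theorem endOfEntries_injective [IsDomain R] (a b c d r s : R) (h : a * d - b * c ≠ 0) :
    Function.Injective (endOfEntries a b c d r s) := by
  rw [injective_iff_map_eq_zero]
  intro x hx
  have hx' := coord_endOfEntries a b c d r s x
  rw [hx, map_zero, Prod.ext_iff, Prod.ext_iff] at hx'
  obtain ⟨h1, h2, h3⟩ := hx'
  simp only [Prod.fst_zero, Prod.snd_zero] at h1 h2 h3
  have e1 : (coord R x).1 = 0 :=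
    (mul_eq_zero_iff_right h).mp (by linear_combination -d * h1 + c * h2)
  have e2 : (coord R x).2.1 = 0 :=
    (mul_eq_zero_iff_right h).mp (by linear_combination b * h1 - a * h2)
  rw [e1, e2] at h3
  have e3 : (coord R x).2.2 = 0 :=
    (mul_eq_zero_iff_right h).mp (by linear_combination - h3)
  apply (coord R).injective
  rw [map_zero]
  exact Prod.ext e1 (Prod.ext e2 e3)

/-- Coordinates are row vectors, so the map applied first contributes the left matrix factor, and
its central entries get multiplied by the determinant of the second. -/
theorem endOfEntries_comp (a b c d r s a' b' c' d' r' s' : R) :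
    (endOfEntries a b c d r s).comp (endOfEntries a' b' c' d' r' s') =
      endOfEntries (a' * a + b' * c) (a' * b + b' * d) (c' * a + d' * c) (c' * b + d' * d)
        (a' * r + b' * s + r' * (a * d - b * c)) (c' * r + d' * s + s' * (a * d - b * c)) := by
  ext x
  apply (coord R).injective
  rw [LieHom.comp_apply, coord_endOfEntries, coord_endOfEntries, coord_endOfEntries]
  ext <;> simp <;> ring

theorem endOfEntries_one : endOfEntries (1 : R) 0 0 1 0 0 = LieHom.id := by
  ext x
  apply (coord R).injective
  rw [coord_endOfEntries]
  ext <;> simp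

/-- The first two basis vectors generate the Lie algebra, so their images determine `f`. -/
theorem exists_eq_endOfEntries (f : R ⊗[ℤ] Heisenberg →ₗ⁅R⁆ R ⊗[ℤ] Heisenberg) :
    ∃ a b c d r s : R, f = endOfEntries a b c d r s := by
  let e : R × R × R → R ⊗[ℤ] Heisenberg := (coord R).symm
  have he : ∀ t, coord R (e t) = t := (coord R).apply_symm_apply
  refine ⟨(coord R (f (e (1, 0, 0)))).1, (coord R (f (e (1, 0, 0)))).2.1,
    (coord R (f (e (0, 1, 0)))).1, (coord R (f (e (0, 1, 0)))).2.1,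
    (coord R (f (e (1, 0, 0)))).2.2, (coord R (f (e (0, 1, 0)))).2.2, LieHom.ext fun x => ?_⟩
  have hz : e (0, 0, 1) = ⁅e (1, 0, 0), e (0, 1, 0)⁆ := by
    apply (coord R).injective
    simp [coord_lie, he]
  have hx : x = (coord R x).1 • e (1, 0, 0) + (coord R x).2.1 • e (0, 1, 0)
      + (coord R x).2.2 • e (0, 0, 1) := by
    apply (coord R).injective
    simp [he]
  apply (coord R).injective
  rw [coord_endOfEntries]
  conv_lhs => rw [hx, hz]
  simp only [map_add, map_smul, LieHom.map_lie, coord_lie]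
  ext <;> simp

end Coordinates
end Heisenberg

/-! ### Triangular representatives of local cosets, and their lifting to integral matrices -/

namespace Heisenberg

section Local

variable {R : Type*} [CommRing R]

theorem endOfEntries_surjective {a b c d : R} (h : IsUnit (a * d - b * c)) (r s : R) :
    Function.Surjective (endOfEntries a b c d r s) := by
  obtain ⟨δ, hδ⟩ := h.exists_left_inv
  -- The matrix part is `δ` times the adjugate; the last two entries solve the linear equations that
  -- make the central part of the composite vanish.
  have h1 : (endOfEntries a b c d r s).comp (endOfEntries (δ * d) (-(δ * b)) (-(δ * c)) (δ * a)
      (-δ * (δ * d * r - δ * b * s)) (-δ * (-(δ * c) * r + δ * a * s))) = LieHom.id := by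
    rw [endOfEntries_comp, ← endOfEntries_one]
    congr 1
    · linear_combination hδ
    · ring
    · ring
    · linear_combination hδ
    · linear_combination (-(δ * d * r - δ * b * s)) * hδ
    · linear_combination (-(-(δ * c) * r + δ * a * s)) * hδ
  exact fun x => ⟨_, LieHom.congr_fun h1 x⟩

variable [IsDomain R]

/-- Precomposing with an automorphism stays in the same coset: these are the row operations used to
normalize representatives. -/
theorem exists_mk_eq_of_comp (α : InjEnd R (R ⊗[ℤ] Heisenberg)) {a b c d : R}
    (h : IsUnit (a * d - b * c)) (r s : R) :
    ∃ β : InjEnd R (R ⊗[ℤ] Heisenberg), Hecke.Coset.mk β = Hecke.Coset.mk α ∧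
      β.toLieHom = α.toLieHom.comp (endOfEntries a b c d r s) := by
  let u : InjEnd R (R ⊗[ℤ] Heisenberg) :=
    ⟨endOfEntries a b c d r s, endOfEntries_injective _ _ _ _ _ _ h.ne_zero⟩
  have hu : IsUnit u := (InjEnd.isUnit_iff u).mpr ⟨u.injective, endOfEntries_surjective h r s⟩
  exact ⟨u * α, Hecke.Coset.mk_unit_mul hu.unit α, rfl⟩

theorem det_ne_zero_of_injective {a b c d r s : R}
    (h : Function.Injective (endOfEntries a b c d r s)) : a * d - b * c ≠ 0 := by
  intro h0
  have : (coord R).symm (0, 0, 1) = 0 := h (by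
    apply (coord R).injective
    rw [coord_endOfEntries, map_zero, map_zero, LinearEquiv.apply_symm_apply, h0]
    ext <;> simp)
  rw [LinearEquiv.map_eq_zero_iff] at this
  simpa using congrArg (fun t : R × R × R => t.2.2) this

/-- Over a valuation ring, every coset contains an upper triangular element. -/
theorem exists_mk_eq_triangular [ValuationRing R] (α : InjEnd R (R ⊗[ℤ] Heisenberg)) :
    ∃ a b d r s : R, a ≠ 0 ∧ d ≠ 0 ∧ ∃ β : InjEnd R (R ⊗[ℤ] Heisenberg),
      Hecke.Coset.mk β = Hecke.Coset.mk α ∧ β.toLieHom = endOfEntries a b 0 d r s := by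
  obtain ⟨a, b, c, d, r, s, hα⟩ := exists_eq_endOfEntries α.toLieHom
  have key : ∃ a b c d r s : R, ∃ β : InjEnd R (R ⊗[ℤ] Heisenberg), c = 0 ∧
      Hecke.Coset.mk β = Hecke.Coset.mk α ∧ β.toLieHom = endOfEntries a b c d r s := by
    -- One of the two entries of the first column divides the other; a row operation, preceded by a
    -- swap of rows in the second case, clears the lower one.
    rcases ValuationRing.dvd_total a c with ⟨k, hk⟩ | ⟨k, hk⟩
    · obtain ⟨β, hβ, hβ'⟩ := exists_mk_eq_of_comp α (a := 1) (b := 0) (c := -k) (d := 1)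
        (by simp) 0 0
      rw [hα, endOfEntries_comp] at hβ'
      refine ⟨_, _, _, _, _, _, β, ?_, hβ, hβ'⟩
      rw [hk]; ring
    · obtain ⟨β, hβ, hβ'⟩ := exists_mk_eq_of_comp α (a := 0) (b := 1) (c := 1) (d := -k)
        (by simp) 0 0
      rw [hα, endOfEntries_comp] at hβ'
      refine ⟨_, _, _, _, _, _, β, ?_, hβ, hβ'⟩
      rw [hk]; ring
  obtain ⟨a, b, _, d, r, s, β, rfl, hβ, hβ'⟩ := key
  have h := det_ne_zero_of_injective (hβ' ▸ β.injective)
  rw [mul_zero, sub_zero] at h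
  exact ⟨a, b, d, r, s, left_ne_zero_of_mul h, right_ne_zero_of_mul h, β, hβ, hβ'⟩

end Local

section Global

/-- The endomorphism of the Heisenberg Lie algebra over `ℤ` which sends the basis vectors `x, y`
to `(a, b, r)` and `(0, d, s)`. -/
def upperTriangular (a b d r s : ℤ) (ha : a ≠ 0) (hd : d ≠ 0) : GlobalMonoid Heisenberg where
  toLieHom :=
    { toFun := fun u => ⟨u.a * a, u.a * b + u.b * d, u.a * r + u.b * s + u.c * (a * d)⟩
      map_add' := fun u v => by ext <;> simp <;> ring
      map_smul' := fun n u => by ext <;> simp <;> ring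
      map_lie' := fun {u v} => by ext <;> simp; ring }
  injective := by
    intro u v h
    rw [Heisenberg.ext_iff] at h
    obtain ⟨h1, h2, h3⟩ := h
    have e1 : u.a = v.a := mul_right_cancel₀ ha h1
    have h2' : u.a * b + u.b * d = v.a * b + v.b * d := h2
    rw [e1] at h2'
    have e2 : u.b = v.b := mul_right_cancel₀ hd (add_left_cancel h2')
    have h3' : u.a * r + u.b * s + u.c * (a * d) = v.a * r + v.b * s + v.c * (a * d) := h3
    rw [e1, e2] at h3'
    exact Heisenberg.ext e1 e2 (mul_right_cancel₀ (mul_ne_zero ha hd) (add_left_cancel h3'))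

theorem toLocal_upperTriangular (a b d r s : ℤ) (ha : a ≠ 0) (hd : d ≠ 0) (p : Nat.Primes) :
    ((upperTriangular a b d r s ha hd).toLocal p).toLieHom =
      endOfEntries (a : ℤ_[(p : ℕ)]) b 0 d r s := by
  ext x
  apply (coord ℤ_[(p : ℕ)]).injective
  rw [coord_endOfEntries]
  induction x using TensorProduct.induction_on with
  | zero =>
    rw [map_zero, map_zero]
    ext <;> simp
  | add x y hx hy =>
    rw [map_add, map_add, hx, hy, map_add]
    ext <;> simp <;> ring
  | tmul t u =>
    have : ((upperTriangular a b d r s ha hd).toLocal p).toLieHom (t ⊗ₜ u) =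
      t ⊗ₜ (⟨u.a * a, u.a * b + u.b * d, u.a * r + u.b * s + u.c * (a * d)⟩ : Heisenberg) := rfl
    rw [this, coord_tmul, coord_tmul]
    ext <;> simp <;> ring

/-- Take the product of the prime powers `q ^ v` with `v` the valuation of `x q`, over the finitely
many relevant `q`; a prime other than `p` is a unit in `ℤ_p`. -/
theorem _root_.PadicInt.exists_int_associated (x : ∀ p : Nat.Primes, ℤ_[(p : ℕ)])
    (hx : ∀ p, x p ≠ 0) (hfin : {p | x p ≠ 1}.Finite) :
    ∃ m : ℤ, m ≠ 0 ∧ ∀ p : Nat.Primes, Associated (x p) (m : ℤ_[(p : ℕ)]) := by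
  classical
  let s := hfin.toFinset
  have hunit : ∀ (p : Nat.Primes) (t : Finset Nat.Primes), p ∉ t →
      IsUnit (∏ q ∈ t, ((q : ℕ) : ℤ_[(p : ℕ)]) ^ (x q).valuation) := by
    intro p t hp
    rw [IsUnit.prod_iff]
    intro q hq
    refine IsUnit.pow _ ?_
    rw [← Int.cast_natCast, ← not_not (a := IsUnit _), PadicInt.not_isUnit_iff,
      PadicInt.norm_int_lt_one_iff_dvd, Int.natCast_dvd_natCast, Nat.prime_dvd_prime_iff_eq p.2 q.2]
    intro h
    exact hp (Subtype.ext h ▸ hq)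
  refine ⟨∏ q ∈ s, ((q : ℕ) : ℤ) ^ (x q).valuation, ?_, fun p => ?_⟩
  · exact Finset.prod_ne_zero_iff.mpr fun q _ => pow_ne_zero _ (by exact_mod_cast q.2.ne_zero)
  · push_cast
    by_cases hp : p ∈ s
    · rw [← Finset.mul_prod_erase s _ hp]
      refine Associated.trans ?_ (associated_mul_unit_right _ _ (hunit p (s.erase p) (by simp)))
      conv_lhs => rw [PadicInt.unitCoeff_spec (hx p)]
      exact associated_unit_mul_left _ _ (Units.isUnit _)
    · have : x p = 1 := by
        by_contra h
        exact hp (hfin.mem_toFinset.mpr h)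
      rw [this]
      exact (associated_one_iff_isUnit.mpr (hunit p s hp)).symm

/-- This is approximation for triangular matrices: the diagonal can be made integral because `ℤ` has
class number one, and the remaining entries matter only modulo the row operations, so density of `ℤ`
in the product of the `ℤ_p` suffices. -/
theorem map_toAdelicHom_surjective :
    Function.Surjective (Hecke.Coset.map (GlobalMonoid.toAdelicHom Heisenberg)) := by
  intro c
  obtain ⟨α, rfl⟩ := c.mk_surj
  have h1 : ∀ p : Nat.Primes, ∃ a b d r s : ℤ_[(p : ℕ)], a ≠ 0 ∧ d ≠ 0 ∧
      (IsUnit (α.1 p) → a = 1 ∧ d = 1) ∧ ∃ β : LocalMonoid Heisenberg p,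
      Hecke.Coset.mk β = Hecke.Coset.mk (α.1 p) ∧ β.toLieHom = endOfEntries a b 0 d r s := by
    intro p
    -- At unit components the identity is taken as representative, so that the diagonal entries are
    -- 1 at almost all primes, as `PadicInt.exists_int_associated` requires.
    by_cases h : IsUnit (α.1 p)
    · refine ⟨1, 0, 1, 0, 0, one_ne_zero, one_ne_zero, fun _ => ⟨rfl, rfl⟩, 1, ?_,
        endOfEntries_one.symm⟩
      exact Hecke.Coset.mk_eq_mk.mpr ⟨h.unit, mul_one _⟩
    · obtain ⟨a, b, d, r, s, ha, hd, h'⟩ := exists_mk_eq_triangular (α.1 p)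
      exact ⟨a, b, d, r, s, ha, hd, fun hu => absurd hu h, h'⟩
  choose a b d r s ha hd hunit β hβ hβ' using h1
  obtain ⟨A, hA0, hA⟩ := PadicInt.exists_int_associated a ha
    ((show Set.Finite {p | ¬ IsUnit (α.1 p)} from α.2).subset fun p hp h => hp (hunit p h).1)
  obtain ⟨D, hD0, hD⟩ := PadicInt.exists_int_associated d hd
    ((show Set.Finite {p | ¬ IsUnit (α.1 p)} from α.2).subset fun p hp h => hp (hunit p h).2)
  choose e he using hA
  choose f hf using hD
  -- Rescaling the rows by `e p` and `f p` gives the diagonal `A`, `D`. The second row corrects `B`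
  -- modulo `D`, and multiples of the central vector correct `S` and `T` modulo `A * D`. The
  -- correction `t` of `B` also changes the central entry of the first row, hence the term `t p * f
  -- p * s p` in the target for `T`.
  obtain ⟨B, hB⟩ := PadicInt.exists_int_dvd_sub hD0 fun p => e p * b p
  choose t ht using hB
  obtain ⟨S, hS⟩ := PadicInt.exists_int_dvd_sub (mul_ne_zero hA0 hD0)
    fun p => f p * s p
  choose v hv using hS
  obtain ⟨T, hT⟩ := PadicInt.exists_int_dvd_sub (mul_ne_zero hA0 hD0)
    fun p => e p * r p + t p * f p * s p
  choose w hw using hT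
  refine ⟨Hecke.Coset.mk (upperTriangular A B D T S hA0 hD0), ?_⟩
  refine AdelicMonoid.mk_eq_mk_iff.mpr fun p => ?_
  obtain ⟨γ, hγ, hγ'⟩ := exists_mk_eq_of_comp (β p) (a := (e p : ℤ_[(p : ℕ)]))
    (b := t p * f p) (c := 0) (d := f p) (by simp)
    (w p * e p * f p) (v p * e p * f p)
  refine Eq.trans ?_ (hγ.trans (hβ p))
  congr 1
  have heq : (GlobalMonoid.toLocal (upperTriangular A B D T S hA0 hD0) p).toLieHom =
      γ.toLieHom := by
    rw [toLocal_upperTriangular, hγ', hβ', endOfEntries_comp]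
    have h1 := he p
    have h2 := hf p
    have h3 := ht p
    have h4 := hv p
    have h5 := hw p
    push_cast at h4 h5
    rw [← h1, ← h2] at h4 h5
    rw [← h2] at h3
    congr 1
    · rw [← h1]; ring
    · linear_combination h3
    · ring
    · rw [← h2]; ring
    · linear_combination h5
    · linear_combination h4
  exact InjEnd.ext fun x => LieHom.congr_fun heq x

theorem map_toAdelicHom_bijective :
    Function.Bijective (Hecke.Coset.map (GlobalMonoid.toAdelicHom Heisenberg)) :=
  ⟨GlobalMonoid.map_toAdelicHom_injective, map_toAdelicHom_surjective⟩

end Global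

end Heisenberg

/-! ## Characteristic functions in Hecke rings -/

namespace HeckeAlg

open Hecke

variable {M : Type*} [Monoid M]

/-- The characteristic function of a finite set of cosets stable under right translation by
invertible elements. -/
noncomputable def charElem (X : Set (Coset M)) (hX : X.Finite)
    (hinv : ∀ (u : Mˣ), ∀ c ∈ X, c.translate (u : M) ∈ X) : HeckeAlg M :=
  ⟨∑ c ∈ hX.toFinset, Finsupp.single c 1, fun u => by
    have hcomp : ∀ (v w : Mˣ) (c : Coset M), v * w = 1 →
        (c.translate (v : M)).translate (w : M) = c := by
      intro v w c h
      obtain ⟨a, rfl⟩ := c.mk_surj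
      simp [mul_assoc, ← Units.val_mul, h]
    rw [map_sum]
    refine Finset.sum_nbij' (Coset.translate (u : M)) (Coset.translate ((u⁻¹ : Mˣ) : M))
      ?_ ?_ ?_ ?_ ?_
    · intro c hc
      rw [Set.Finite.mem_toFinset] at hc ⊢
      exact hinv u c hc
    · intro c hc
      rw [Set.Finite.mem_toFinset] at hc ⊢
      exact hinv u⁻¹ c hc
    · exact fun c _ => hcomp u u⁻¹ c (mul_inv_cancel u)
    · exact fun c _ => hcomp u⁻¹ u c (inv_mul_cancel u)
    · intro c _
      obtain ⟨a, rfl⟩ := c.mk_surj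
      simp⟩

section charElem

variable {X : Set (Coset M)} (hX : X.Finite)
  (hXinv : ∀ (u : Mˣ), ∀ c ∈ X, c.translate (u : M) ∈ X)

theorem val_charElem :
    val (charElem X hX hXinv) = ∑ c ∈ hX.toFinset, Finsupp.single c 1 := rfl

open scoped Classical in
theorem coeff_charElem (a : M) :
    (charElem X hX hXinv).coeff a = if Coset.mk a ∈ X then 1 else 0 := by
  rw [coeff, val_charElem, Finsupp.finsetSum_apply]
  simp [Finsupp.single_apply]

/-- The product is the sum of the translates of the cosets in `X` by representatives of those in
`Y`; the bijection says that each coset of `Z` occurs exactly once. -/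
theorem charElem_mul {Y Z : Set (Coset M)} (hY : Y.Finite)
    (hYinv : ∀ (u : Mˣ), ∀ c ∈ Y, c.translate (u : M) ∈ Y) (hZ : Z.Finite)
    (hZinv : ∀ (u : Mˣ), ∀ c ∈ Z, c.translate (u : M) ∈ Z) (β : Coset M → M)
    (hβ : ∀ y ∈ Y, Coset.mk (β y) = y)
    (hbij : Set.BijOn (fun z : Coset M × Coset M => z.1.translate (β z.2)) (X ×ˢ Y) Z) :
    charElem X hX hXinv * charElem Y hY hYinv = charElem Z hZ hZinv := by
  apply val_injective
  rw [val_mul, val_charElem, val_charElem, map_sum]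
  have h : ∀ y ∈ hY.toFinset, mulVal (charElem X hX hXinv) (Finsupp.single y 1) =
      ∑ x ∈ hX.toFinset, Finsupp.single (x.translate (β y)) 1 := by
    intro y hy
    have hy' := hβ y (hY.mem_toFinset.mp hy)
    conv_lhs => rw [← hy']
    rw [mulVal_single, one_smul, val_charElem, map_sum]
    refine Finset.sum_congr rfl fun x _ => ?_
    obtain ⟨a, rfl⟩ := x.mk_surj
    simp
  rw [Finset.sum_congr rfl h, Finset.sum_comm, ← Finset.sum_product']
  refine Finset.sum_nbij (fun z : Coset M × Coset M => z.1.translate (β z.2)) ?_ ?_ ?_ fun _ _ => rfl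
  · intro z hz
    rw [Finset.mem_product, hX.mem_toFinset, hY.mem_toFinset] at hz
    exact hZ.mem_toFinset.mpr (hbij.mapsTo hz)
  · rw [Finset.coe_product, hX.coe_toFinset, hY.coe_toFinset]
    exact hbij.injOn
  · rw [Finset.coe_product, hX.coe_toFinset, hY.coe_toFinset, hZ.coe_toFinset]
    exact hbij.surjOn

end charElem

end HeckeAlg

/-! ## The Euler product -/

namespace AdelicMonoid

open Hecke

variable {L : Type*} [LieRing L]

open scoped Classical in
/-- The endomorphism of `Δ̂_L` which replaces the components outside a set of primes by `1`. -/
noncomputable def restrict (S : Set Nat.Primes) : AdelicMonoid L →* AdelicMonoid L where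
  toFun α := ⟨fun p => if p ∈ S then α.1 p else 1, by
    refine (show Set.Finite {p | ¬ IsUnit (α.1 p)} from α.2).subset fun p hp h => hp ?_
    dsimp only
    split_ifs
    · exact h
    · exact isUnit_one⟩
  map_one' := by
    ext p : 2
    exact ite_self _
  map_mul' α β := by
    ext p : 2
    change (if p ∈ S then α.1 p * β.1 p else 1) =
      (if p ∈ S then α.1 p else 1) * (if p ∈ S then β.1 p else 1)
    split_ifs <;> simp

theorem restrict_apply_of_mem {S : Set Nat.Primes} {p : Nat.Primes} (h : p ∈ S)
    (α : AdelicMonoid L) : (restrict S α).1 p = α.1 p := if_pos h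

theorem restrict_apply_of_notMem {S : Set Nat.Primes} {p : Nat.Primes} (h : p ∉ S)
    (α : AdelicMonoid L) : (restrict S α).1 p = 1 := if_neg h

theorem restrict_restrict (S T : Set Nat.Primes) (α : AdelicMonoid L) :
    restrict S (restrict T α) = restrict (S ∩ T) α := by
  ext p : 2
  by_cases hS : p ∈ S <;> by_cases hT : p ∈ T <;>
    simp [restrict_apply_of_mem, restrict_apply_of_notMem, hS, hT]

theorem restrict_empty (α : AdelicMonoid L) : restrict ∅ α = 1 := by
  ext p : 2
  exact restrict_apply_of_notMem (Set.notMem_empty p) α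

theorem restrict_univ (α : AdelicMonoid L) : restrict Set.univ α = α := by
  ext p : 2
  exact restrict_apply_of_mem (Set.mem_univ p) α

theorem restrict_mul_restrict {S T : Set Nat.Primes} (h : Disjoint S T) (α : AdelicMonoid L) :
    restrict S α * restrict T α = restrict (S ∪ T) α := by
  ext p : 2
  change (restrict S α).1 p * (restrict T α).1 p = _
  by_cases hS : p ∈ S
  · have hT : p ∉ T := Set.disjoint_left.mp h hS
    simp [restrict_apply_of_mem, restrict_apply_of_notMem, hS, hT]
  · by_cases hT : p ∈ T <;> simp [restrict_apply_of_mem, restrict_apply_of_notMem, hS, hT]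

theorem restrict_commute {S T : Set Nat.Primes} (h : Disjoint S T) (α β : AdelicMonoid L) :
    restrict S α * restrict T β = restrict T β * restrict S α := by
  ext p : 2
  change (restrict S α).1 p * (restrict T β).1 p = (restrict T β).1 p * (restrict S α).1 p
  by_cases hS : p ∈ S
  · have hT : p ∉ T := Set.disjoint_left.mp h hS
    simp [restrict_apply_of_notMem, hT]
  · simp [restrict_apply_of_notMem, hS]

theorem restrict_singleton (p : Nat.Primes) (α : AdelicMonoid L) :
    restrict {p} α = LocalMonoid.toAdelic p (α.1 p) := by
  ext q : 2
  by_cases h : q = p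
  · subst h
    rw [restrict_apply_of_mem (Set.mem_singleton q), LocalMonoid.toAdelic_apply_same]
  · rw [restrict_apply_of_notMem (by simpa using h), LocalMonoid.toAdelic_apply_of_ne h]

/-- The cosets of index `n` whose components outside `S` are trivial. -/
def cosetsOfIndex (L : Type*) [LieRing L] (S : Set Nat.Primes) (n : ℕ) :
    Set (Coset (AdelicMonoid L)) :=
  {c | Coset.map (restrict S) c = c ∧ c.index (indexHom L) = n}

theorem translate_mem_cosetsOfIndex (S : Set Nat.Primes) (n : ℕ) (u : (AdelicMonoid L)ˣ) :
    ∀ c ∈ cosetsOfIndex L S n, c.translate (u : AdelicMonoid L) ∈ cosetsOfIndex L S n := by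
  intro c hc
  obtain ⟨α, rfl⟩ := c.mk_surj
  obtain ⟨h1, h2⟩ := hc
  refine ⟨?_, ?_⟩
  · refine mk_eq_mk_iff.mpr fun p => ?_
    have h := mk_eq_mk_iff.mp h1 p
    by_cases hp : p ∈ S
    · rw [restrict_apply_of_mem hp]
    · rw [restrict_apply_of_notMem hp] at h ⊢
      obtain ⟨v, hv⟩ := Coset.mk_eq_mk.mp h
      have hu : IsUnit (u.val.1 p) := isUnit_iff.mp u.isUnit p
      refine Coset.mk_eq_mk.mpr ⟨v * hu.unit, ?_⟩
      change _ = α.1 p * u.val.1 p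
      rw [← hv]
      simp
  · rw [Coset.translate_mk, Coset.index_mk, map_mul, map_unit_eq_one, mul_one]
    exact h2

theorem finite_cosetsOfIndex
    (hfin : ∀ n, 0 < n → {c : Coset (AdelicMonoid L) | c.index (indexHom L) = n}.Finite)
    (S : Set Nat.Primes) {n : ℕ} (hn : 0 < n) : (cosetsOfIndex L S n).Finite :=
  (hfin n hn).subset fun _ hc => hc.2

/-- The formal Dirichlet series of the cosets whose components outside `S` are trivial. -/
noncomputable def partialSeries
    (hfin : ∀ n, 0 < n → {c : Coset (AdelicMonoid L) | c.index (indexHom L) = n}.Finite)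
    (S : Set Nat.Primes) : ArithmeticFunction (AdelicHecke L) :=
  ⟨fun n => if h : 0 < n then HeckeAlg.charElem (cosetsOfIndex L S n)
    (finite_cosetsOfIndex hfin S h) (translate_mem_cosetsOfIndex S n) else 0, dif_neg (lt_irrefl 0)⟩

open scoped Classical in
theorem coeff_partialSeries
    (hfin : ∀ n, 0 < n → {c : Coset (AdelicMonoid L) | c.index (indexHom L) = n}.Finite)
    (S : Set Nat.Primes) {n : ℕ} (hn : 0 < n) (α : AdelicMonoid L) :
    (partialSeries hfin S n).coeff α =
      if Coset.mk (restrict S α) = Coset.mk α ∧ index α = n then 1 else 0 := by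
  have : partialSeries hfin S n = HeckeAlg.charElem (cosetsOfIndex L S n)
      (finite_cosetsOfIndex hfin S hn) (translate_mem_cosetsOfIndex S n) := dif_pos hn
  rw [this, HeckeAlg.coeff_charElem]
  exact if_congr Iff.rfl rfl rfl

/-- The cosets whose components outside `S ∪ T` are trivial, and whose `S`- and `T`-components have
given indices. -/
def cosetsOfIndices (L : Type*) [LieRing L] (S T : Set Nat.Primes) (d e : ℕ) :
    Set (Coset (AdelicMonoid L)) :=
  {c | Coset.map (restrict (S ∪ T)) c = c ∧ (Coset.map (restrict S) c).index (indexHom L) = d ∧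
    (Coset.map (restrict T) c).index (indexHom L) = e}

theorem cosetsOfIndices_subset {S T : Set Nat.Primes} (h : Disjoint S T) (d e : ℕ) :
    cosetsOfIndices L S T d e ⊆ cosetsOfIndex L (S ∪ T) (d * e) := by
  rintro c ⟨h1, h2, h3⟩
  refine ⟨h1, ?_⟩
  rw [← h2, ← h3, ← h1]
  obtain ⟨α, rfl⟩ := c.mk_surj
  simp only [Coset.map_mk, Coset.index_mk, restrict_restrict]
  rw [← restrict_mul_restrict h, map_mul, Set.inter_eq_left.mpr Set.subset_union_left,
    Set.inter_eq_left.mpr Set.subset_union_right]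

theorem translate_mem_cosetsOfIndices {S T : Set Nat.Primes} (d e : ℕ) (u : (AdelicMonoid L)ˣ) :
    ∀ c ∈ cosetsOfIndices L S T d e,
      c.translate (u : AdelicMonoid L) ∈ cosetsOfIndices L S T d e := by
  rintro c ⟨h1, h2, h3⟩
  have h (U : Set Nat.Primes) : (Coset.map (restrict U) (c.translate (u : AdelicMonoid L))).index
      (indexHom L) = (Coset.map (restrict U) c).index (indexHom L) := by
    have hu : indexHom L (restrict U (u : AdelicMonoid L)) = 1 :=
      map_unit_eq_one (indexHom L) (Units.map (restrict U) u)
    rw [Coset.map_translate]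
    obtain ⟨α, rfl⟩ := c.mk_surj
    rw [Coset.map_mk, Coset.translate_mk, Coset.index_mk, Coset.index_mk, map_mul, hu, mul_one]
  exact ⟨(translate_mem_cosetsOfIndex (S ∪ T) _ u c ⟨h1, rfl⟩).1, (h S).trans h2, (h T).trans h3⟩

/-- The inverse sends a coset to its `S`-part and its `T`-part. The chosen representative of the
second factor is restricted to `T`, since it may have nontrivial units elsewhere that would disturb
the `S`-part. -/
theorem bijOn_cosetsOfIndices {S T : Set Nat.Primes} (h : Disjoint S T) (d e : ℕ) :
    Set.BijOn (fun z : Coset (AdelicMonoid L) × Coset (AdelicMonoid L) =>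
      z.1.translate (restrict T (z.2.out)))
      (cosetsOfIndex L S d ×ˢ cosetsOfIndex L T e) (cosetsOfIndices L S T d e) := by
  have hST : S ∩ T = ∅ := h.inter_eq
  have hTS : T ∩ S = ∅ := h.symm.inter_eq
  have hS (α β : AdelicMonoid L) : restrict S (restrict S α * restrict T β) = restrict S α := by
    rw [map_mul, restrict_restrict, restrict_restrict, Set.inter_self, hST, restrict_empty, mul_one]
  have hT (α β : AdelicMonoid L) : restrict T (restrict S α * restrict T β) = restrict T β := by
    rw [map_mul, restrict_restrict, restrict_restrict, Set.inter_self, hTS, restrict_empty, one_mul]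
  have hinv : ∀ z ∈ cosetsOfIndex L S d ×ˢ cosetsOfIndex L T e,
      (fun c => (Coset.map (restrict S) c, Coset.map (restrict T) c))
        (z.1.translate (restrict T (z.2.out))) = z := by
    rintro ⟨c, c'⟩ ⟨⟨hc, -⟩, ⟨hc', -⟩⟩
    dsimp only at hc hc' ⊢
    obtain ⟨α, rfl⟩ := c.mk_surj
    rw [Coset.map_mk] at hc
    rw [← hc, Coset.translate_mk, Coset.map_mk, Coset.map_mk, hS, hT,
      ← Coset.map_mk (restrict T), Coset.mk_out, hc']
  refine ⟨?_, ?_, ?_⟩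
  · rintro z hz
    have hz' := hinv z hz
    rw [Prod.ext_iff] at hz'
    obtain ⟨e1, e2⟩ := hz'
    dsimp only at e1 e2
    obtain ⟨⟨h1, h2⟩, ⟨h3, h4⟩⟩ := hz
    refine ⟨?_, by rw [e1, h2], by rw [e2, h4]⟩
    obtain ⟨c, c'⟩ := z
    dsimp only at *
    obtain ⟨α, rfl⟩ := c.mk_surj
    rw [Coset.map_mk] at h1
    rw [← h1, Coset.translate_mk, Coset.map_mk, ← restrict_mul_restrict h, hS, hT]
  · intro z hz w hw hzw
    rw [← hinv z hz, ← hinv w hw]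
    exact congrArg (fun c => (Coset.map (restrict S) c, Coset.map (restrict T) c)) hzw
  · rintro c ⟨h1, h2, h3⟩
    obtain ⟨α, rfl⟩ := c.mk_surj
    rw [Coset.map_mk] at h1 h2 h3
    refine ⟨(Coset.mk (restrict S α), Coset.mk (restrict T α)), ⟨⟨?_, h2⟩, ⟨?_, h3⟩⟩, ?_⟩
    · rw [Coset.map_mk, restrict_restrict, Set.inter_self]
    · rw [Coset.map_mk, restrict_restrict, Set.inter_self]
    · dsimp only
      obtain ⟨u, hu⟩ := Coset.mk_eq_mk.mp (Coset.mk_out (Coset.mk (restrict T α))).symm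
      have hu' : restrict T (Coset.mk (restrict T α)).out =
          restrict T (u : AdelicMonoid L) * restrict T α := by
        rw [← hu, map_mul, restrict_restrict, Set.inter_self]
      -- The unit `u` relating the two representatives is supported on `T`, so it commutes past the
      -- `S`-part and is absorbed on the left.
      rw [Coset.translate_mk, hu', ← mul_assoc, restrict_commute h, mul_assoc,
        restrict_mul_restrict h]
      exact (Coset.mk_unit_mul (Units.map (restrict T) u) _).trans h1

/-- The term of the convolution for `n = d * e` counts the cosets with `S`-index `d` and `T`-index
`e`; a coset of index `n` supported on `S ∪ T` occurs for exactly one such pair. -/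
theorem partialSeries_mul
    (hfin : ∀ n, 0 < n → {c : Coset (AdelicMonoid L) | c.index (indexHom L) = n}.Finite)
    {S T : Set Nat.Primes} (h : Disjoint S T) :
    partialSeries hfin S * partialSeries hfin T = partialSeries hfin (S ∪ T) := by
  classical
  ext n
  rcases Nat.eq_zero_or_pos n with rfl | hn
  · simp
  refine HeckeAlg.ext_coeff fun α => ?_
  rw [ArithmeticFunction.mul_apply, HeckeAlg.coeff_sum, coeff_partialSeries hfin _ hn]
  have hterm : ∀ z ∈ n.divisorsAntidiagonal,
      (partialSeries hfin S z.1 * partialSeries hfin T z.2).coeff α =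
        if Coset.mk α ∈ cosetsOfIndices L S T z.1 z.2 then 1 else 0 := by
    intro z hz
    have hz' := Nat.mem_divisorsAntidiagonal.mp hz
    have hd : 0 < z.1 := Nat.pos_of_ne_zero fun h0 => hn.ne' (by rw [← hz'.1, h0, zero_mul])
    have he : 0 < z.2 := Nat.pos_of_ne_zero fun h0 => hn.ne' (by rw [← hz'.1, h0, mul_zero])
    have h1 : partialSeries hfin S z.1 = HeckeAlg.charElem (cosetsOfIndex L S z.1)
      (finite_cosetsOfIndex hfin S hd) (translate_mem_cosetsOfIndex S z.1) := dif_pos hd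
    have h2 : partialSeries hfin T z.2 = HeckeAlg.charElem (cosetsOfIndex L T z.2)
      (finite_cosetsOfIndex hfin T he) (translate_mem_cosetsOfIndex T z.2) := dif_pos he
    rw [h1, h2, HeckeAlg.charElem_mul _ _ _ _
      ((finite_cosetsOfIndex hfin (S ∪ T) (Nat.mul_pos hd he)).subset (cosetsOfIndices_subset h _ _))
      (translate_mem_cosetsOfIndices _ _) (fun c => restrict T c.out) ?_
      (bijOn_cosetsOfIndices h _ _), HeckeAlg.coeff_charElem]
    intro c hc
    rw [← Coset.map_mk, Coset.mk_out]
    exact hc.1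
  rw [Finset.sum_congr rfl hterm]
  by_cases hα : Coset.mk (restrict (S ∪ T) α) = Coset.mk α ∧ index α = n
  · rw [if_pos hα]
    have hmem : Coset.mk α ∈
        cosetsOfIndices L S T (index (restrict S α)) (index (restrict T α)) := ⟨hα.1, rfl, rfl⟩
    have hidx := (cosetsOfIndices_subset h _ _ hmem).2
    rw [Coset.index_mk, coe_indexHom, hα.2] at hidx
    rw [Finset.sum_eq_single (index (restrict S α), index (restrict T α)), if_pos hmem]
    · rintro z - hz
      rw [if_neg]
      rintro ⟨-, h2, h3⟩
      exact hz (Prod.ext h2.symm h3.symm)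
    · intro hz
      exact absurd (Nat.mem_divisorsAntidiagonal.mpr ⟨hidx.symm, hn.ne'⟩) hz
  · rw [if_neg hα]
    refine Finset.sum_eq_zero fun z hz => if_neg fun hmem => hα ?_
    have := cosetsOfIndices_subset h _ _ hmem
    rw [(Nat.mem_divisorsAntidiagonal.mp hz).1] at this
    exact this

theorem partialSeries_empty
    (hfin : ∀ n, 0 < n → {c : Coset (AdelicMonoid L) | c.index (indexHom L) = n}.Finite) :
    partialSeries hfin ∅ = 1 := by
  classical
  ext n
  rcases Nat.eq_zero_or_pos n with rfl | hn
  · simp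
  refine HeckeAlg.ext_coeff fun α => ?_
  rw [coeff_partialSeries hfin _ hn, restrict_empty]
  have h1 (α : AdelicMonoid L) : HeckeAlg.coeff 1 α = if Coset.mk 1 = Coset.mk α then 1 else 0 := by
    rw [HeckeAlg.coeff, HeckeAlg.val_one, Finsupp.single_apply]
  have h2 : Coset.mk 1 = Coset.mk α → index α = 1 := fun h => by
    have := congrArg (Coset.index (indexHom L)) h
    rw [Coset.index_mk, Coset.index_mk, map_one] at this
    exact this.symm
  by_cases hn1 : n = 1
  · subst hn1
    rw [ArithmeticFunction.one_one, h1]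
    exact if_congr (and_iff_left_of_imp h2) rfl rfl
  · rw [ArithmeticFunction.one_apply_ne hn1, HeckeAlg.coeff_zero, if_neg]
    rintro ⟨h, rfl⟩
    exact hn1 (h2 h)

theorem prod_map_partialSeries
    (hfin : ∀ n, 0 < n → {c : Coset (AdelicMonoid L) | c.index (indexHom L) = n}.Finite)
    (l : List Nat.Primes) (hl : l.Nodup) :
    (l.map fun p => partialSeries hfin {p}).prod = partialSeries hfin {p | p ∈ l} := by
  induction l with
  | nil => simp [← partialSeries_empty hfin]
  | cons p l ih =>
    rw [List.nodup_cons] at hl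
    rw [List.map_cons, List.prod_cons, ih hl.2, partialSeries_mul]
    · congr 1
      ext q
      simp
    · exact Set.disjoint_singleton_left.mpr hl.1

end AdelicMonoid

theorem evalPrimePow_apply_pow {A : Type*} [Semiring A] (p : Nat.Primes) (P : PowerSeries A)
    (k : ℕ) : evalPrimePow p P ((p : ℕ) ^ k) = PowerSeries.coeff k P :=
  (Nat.pow_right_injective p.2.two_le).extend_apply (fun k => PowerSeries.coeff k P) 0 k

theorem evalPrimePow_apply_of_forall_ne {A : Type*} [Semiring A] (p : Nat.Primes)
    (P : PowerSeries A) {n : ℕ} (h : ¬ ∃ k, (p : ℕ) ^ k = n) : evalPrimePow p P n = 0 :=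
  Function.extend_apply' (fun k : ℕ => PowerSeries.coeff k P) (0 : ℕ → A) n h

/-! ### Embedding the local Hecke rings -/

section LocalToAdelic

open Hecke

variable {L : Type*} [LieRing L]

/-- The canonical inclusion `Δ_{L_p} → Δ̂_L` as a homomorphism of monoids. -/
noncomputable def LocalMonoid.toAdelicHom (p : Nat.Primes) :
    LocalMonoid L p →* AdelicMonoid L where
  toFun := LocalMonoid.toAdelic p
  map_one' := by
    classical
    exact Subtype.ext (Pi.mulSingle_one (M := fun q : Nat.Primes => LocalMonoid L q) p)
  map_mul' α β := by
    classical
    exact Subtype.ext (Pi.mulSingle_mul (f := fun q : Nat.Primes => LocalMonoid L q) p α β)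

theorem LocalMonoid.map_toAdelicHom_injective (p : Nat.Primes) :
    Function.Injective (Coset.map (LocalMonoid.toAdelicHom (L := L) p)) := by
  intro c d h
  obtain ⟨α, rfl⟩ := c.mk_surj
  obtain ⟨β, rfl⟩ := d.mk_surj
  have hp := AdelicMonoid.mk_eq_mk_iff.mp h p
  change Coset.mk ((LocalMonoid.toAdelic p α).1 p) = Coset.mk ((LocalMonoid.toAdelic p β).1 p) at hp
  rwa [LocalMonoid.toAdelic_apply_same, LocalMonoid.toAdelic_apply_same] at hp

/-- Away from `p` the product is just a unit, which disappears in the coset; only the component of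
`u` at `p` acts. -/
theorem LocalMonoid.exists_unit_mk_toAdelic_mul (p : Nat.Primes) (u : (AdelicMonoid L)ˣ) :
    ∃ v : (LocalMonoid L p)ˣ, ∀ α : LocalMonoid L p,
      Coset.mk (LocalMonoid.toAdelicHom p α * (u : AdelicMonoid L)) =
        Coset.mk (LocalMonoid.toAdelicHom p (α * (v : LocalMonoid L p))) := by
  have hu := AdelicMonoid.isUnit_iff.mp u.isUnit
  refine ⟨(hu p).unit, fun α => AdelicMonoid.mk_eq_mk_iff.mpr fun q => ?_⟩
  change Coset.mk ((LocalMonoid.toAdelic p α).1 q * u.val.1 q) =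
    Coset.mk ((LocalMonoid.toAdelic p (α * u.val.1 p)).1 q)
  by_cases h : q = p
  · subst h
    rw [LocalMonoid.toAdelic_apply_same, LocalMonoid.toAdelic_apply_same]
  · rw [LocalMonoid.toAdelic_apply_of_ne h, LocalMonoid.toAdelic_apply_of_ne h, one_mul]
    exact (Coset.mk_eq_mk.mpr ⟨(hu q).unit, mul_one _⟩).symm

/-- The embedding `R_{L_p} → R̂_L`. -/
noncomputable def LocalHecke.toAdelic (L : Type*) [LieRing L] (p : Nat.Primes) :
    LocalHecke L p →+* AdelicHecke L :=
  HeckeAlg.push (LocalMonoid.toAdelicHom p) (LocalMonoid.exists_unit_mk_toAdelic_mul p)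

end LocalToAdelic

namespace AdelicMonoid

open Hecke

variable {L : Type*} [LieRing L] [Module.Free ℤ L] [Module.Finite ℤ L]

theorem index_pos (α : AdelicMonoid L) : 0 < index α := by
  rw [index_eq_prod α (show Set.Finite {p | ¬ IsUnit (α.1 p)} from α.2).toFinset fun p hp => by
    by_contra h
    exact hp ((Set.Finite.mem_toFinset _).mpr h)]
  refine Finset.prod_pos fun p _ => ?_
  rw [LocalMonoid.index_eq]
  exact pow_pos p.2.pos _

theorem finite_setOf_index_eq
    (hsurj : Function.Surjective (Coset.map (GlobalMonoid.toAdelicHom L))) {n : ℕ} (hn : 0 < n) :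
    {c : Coset (AdelicMonoid L) | c.index (indexHom L) = n}.Finite := by
  refine ((GlobalMonoid.finite_cosets_of_index (L := L) hn).image
    (Coset.map (GlobalMonoid.toAdelicHom L))).subset fun c hc => ?_
  obtain ⟨d, rfl⟩ := hsurj c
  refine ⟨d, ?_, rfl⟩
  obtain ⟨α, rfl⟩ := d.mk_surj
  exact (GlobalMonoid.index_toAdelic α).symm.trans hc

end AdelicMonoid

/-! ### Identification of the series and the Euler products -/

section Series

open Hecke

variable {L : Type*} [LieRing L] [Module.Free ℤ L] [Module.Finite ℤ L]

theorem GlobalMonoid.finitenessConditions :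
    FinitenessConditions (M := GlobalMonoid L) InjEnd.index :=
  finitenessConditions_of_finite_cosets (InjEnd.indexHom ℤ L) GlobalMonoid.index_pos
    fun _ hn => GlobalMonoid.finite_cosets_of_index hn

variable (hfin : ∀ n, 0 < n →
  {c : Coset (AdelicMonoid L) | c.index (AdelicMonoid.indexHom L) = n}.Finite)

theorem AdelicMonoid.finitenessConditions
    (hfin : ∀ n, 0 < n →
      {c : Coset (AdelicMonoid L) | c.index (AdelicMonoid.indexHom L) = n}.Finite) :
    FinitenessConditions (M := AdelicMonoid L) AdelicMonoid.index :=
  finitenessConditions_of_finite_cosets (AdelicMonoid.indexHom L) AdelicMonoid.index_pos hfin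

/-- The inclusion at `p` preserves the index and is injective on cosets, so finiteness is inherited
from the adelic monoid. -/
theorem LocalMonoid.finitenessConditions
    (hfin : ∀ n, 0 < n →
      {c : Coset (AdelicMonoid L) | c.index (AdelicMonoid.indexHom L) = n}.Finite)
    (p : Nat.Primes) : FinitenessConditions (M := LocalMonoid L p) InjEnd.index := by
  refine finitenessConditions_of_finite_cosets (InjEnd.indexHom _ _) (fun α => ?_) fun n hn => ?_
  · rw [InjEnd.coe_indexHom, LocalMonoid.index_eq]
    exact pow_pos p.2.pos _
  · refine ((hfin n hn).preimage (LocalMonoid.map_toAdelicHom_injective p).injOn).subset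
      fun c hc => ?_
    obtain ⟨α, rfl⟩ := c.mk_surj
    exact (LocalMonoid.index_toAdelic p α).trans hc

theorem adelicSeries_eq_partialSeries : adelicSeries L = AdelicMonoid.partialSeries hfin Set.univ := by
  classical
  ext n
  rcases Nat.eq_zero_or_pos n with rfl | hn
  · simp
  refine HeckeAlg.ext_coeff fun α => ?_
  rw [AdelicMonoid.coeff_partialSeries hfin _ hn, AdelicMonoid.restrict_univ]
  have : adelicSeries L n = sumOfIndex (AdelicMonoid.indexHom L) n := if_neg hn.ne'
  rw [this, HeckeAlg.coeff_sumOfIndex _ (AdelicMonoid.finitenessConditions hfin) hn]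
  exact if_congr (by simp) rfl rfl

theorem AdelicMonoid.partialSeries_apply_of_dvd {S : Set Nat.Primes} {n : ℕ}
    (hS : ∀ p : Nat.Primes, (p : ℕ) ∣ n → p ∈ S) :
    partialSeries hfin S n = adelicSeries L n := by
  classical
  rw [adelicSeries_eq_partialSeries hfin]
  rcases Nat.eq_zero_or_pos n with rfl | hn
  · simp
  refine HeckeAlg.ext_coeff fun α => ?_
  rw [coeff_partialSeries hfin _ hn, coeff_partialSeries hfin _ hn, restrict_univ]
  refine if_congr (and_congr_left fun hα => iff_of_true ?_ rfl) rfl rfl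
  refine mk_eq_mk_iff.mpr fun p => ?_
  by_cases hp : p ∈ S
  · rw [restrict_apply_of_mem hp]
  · have hunit : IsUnit (α.1 p) := by
      rw [InjEnd.isUnit_iff_index_eq_one]
      have hdvd : (α.1 p).index ∣ n := by
        rw [← hα, ← LocalMonoid.index_toAdelic, ← restrict_singleton]
        -- Splitting `α` into its part at `p` and the rest shows that the local index divides `n`.
        have h := congrArg (indexHom L) (restrict_mul_restrict (L := L)
          (disjoint_compl_right (a := ({p} : Set Nat.Primes))) α)
        rw [map_mul, Set.union_compl_self, restrict_univ] at h
        exact Dvd.intro _ h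
      rw [LocalMonoid.index_eq] at hdvd ⊢
      rcases Nat.eq_zero_or_pos (LinearMap.det ((α.1 p).toLieHom :
        LocalLie L p →ₗ[ℤ_[(p : ℕ)]] LocalLie L p)).valuation with h | h
      · rw [h, pow_zero]
      · exact absurd (hS p ((dvd_pow_self _ h.ne').trans hdvd)) hp
    rw [restrict_apply_of_notMem hp]
    exact Coset.mk_eq_mk.mpr ⟨hunit.unit, mul_one _⟩

/-- The adelic cosets coming from the local monoid at `p` are exactly those trivial outside `p`, and
they keep their index. -/
theorem LocalHecke.toAdelic_sumOfIndex (p : Nat.Primes) {n : ℕ} (hn : 0 < n) :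
    LocalHecke.toAdelic L p (sumOfIndex (M := LocalMonoid L p) InjEnd.index n) =
      AdelicMonoid.partialSeries hfin {p} n := by
  classical
  refine HeckeAlg.ext_coeff fun α => ?_
  rw [AdelicMonoid.coeff_partialSeries hfin _ hn, AdelicMonoid.restrict_singleton]
  by_cases h : Coset.mk (LocalMonoid.toAdelic p (α.1 p)) = Coset.mk α
  · refine (HeckeAlg.coeff_push _ _ (LocalMonoid.map_toAdelicHom_injective p) _ h.symm).trans ?_
    refine (HeckeAlg.coeff_sumOfIndex (InjEnd.indexHom _ _)
      (LocalMonoid.finitenessConditions hfin p) hn _).trans ?_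
    refine if_congr ?_ rfl rfl
    have hidx : (α.1 p).index = AdelicMonoid.index α :=
      (LocalMonoid.index_toAdelic p (α.1 p)).symm.trans
        (congrArg (Coset.index (AdelicMonoid.indexHom L)) h)
    rw [and_iff_right h, ← hidx]
    rfl
  · rw [if_neg fun h' => h h'.1]
    refine HeckeAlg.coeff_push_of_notMem _ _ _ fun a ha => h ?_
    have h1 := AdelicMonoid.mk_eq_mk_iff.mp ha
    refine AdelicMonoid.mk_eq_mk_iff.mpr fun q => ?_
    by_cases hq : q = p
    · subst hq
      rw [LocalMonoid.toAdelic_apply_same]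
    · rw [LocalMonoid.toAdelic_apply_of_ne hq, h1 q]
      exact congrArg Coset.mk (LocalMonoid.toAdelic_apply_of_ne hq a).symm

theorem evalPrimePow_localSeries (p : Nat.Primes) :
    evalPrimePow p (PowerSeries.map (LocalHecke.toAdelic L p) (localSeries L p)) =
      AdelicMonoid.partialSeries hfin {p} := by
  classical
  ext n
  by_cases h : ∃ k, (p : ℕ) ^ k = n
  · obtain ⟨k, rfl⟩ := h
    rw [evalPrimePow_apply_pow, PowerSeries.coeff_map, localSeries,
      powerSeries, PowerSeries.coeff_mk]
    exact LocalHecke.toAdelic_sumOfIndex hfin p (pow_pos p.2.pos k)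
  · rw [evalPrimePow_apply_of_forall_ne p _ h]
    rcases Nat.eq_zero_or_pos n with rfl | hn
    · simp
    refine HeckeAlg.ext_coeff fun α => ?_
    rw [AdelicMonoid.coeff_partialSeries hfin _ hn, if_neg]
    · exact HeckeAlg.coeff_zero α
    -- A coset supported at `p` has index a power of `p`, so none has index `n`.
    · rintro ⟨h1, h2⟩
      refine h ⟨_, (LocalMonoid.index_eq p (α.1 p)).symm.trans ?_⟩
      rw [← h2, ← LocalMonoid.index_toAdelic, ← AdelicMonoid.restrict_singleton]
      exact congrArg (Coset.index (AdelicMonoid.indexHom L)) h1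

theorem hasFormalEulerProduct_adelicSeries
    (hfin : ∀ n, 0 < n →
      {c : Coset (AdelicMonoid L) | c.index (AdelicMonoid.indexHom L) = n}.Finite) :
    HasFormalEulerProduct (fun p => evalPrimePow p (PowerSeries.map (LocalHecke.toAdelic L p) (localSeries L p)))
    (adelicSeries L) := by
  simp_rw [evalPrimePow_localSeries hfin]
  intro n
  rcases Nat.eq_zero_or_pos n with rfl | hn
  · exact ⟨∅, fun l _ _ => by simp⟩
  refine ⟨n.primeFactors.subtype Nat.Prime, fun l hl h => ?_⟩
  rw [AdelicMonoid.prod_map_partialSeries hfin l hl]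
  exact AdelicMonoid.partialSeries_apply_of_dvd hfin fun p hp =>
    h p (Finset.mem_subtype.mpr (Nat.mem_primeFactors.mpr ⟨p.2, hp, hn.ne'⟩))

/-- Both coefficients are characteristic functions of an index, and the diagonal map preserves
indices. -/
theorem pull_adelicSeries (hbij : Function.Bijective (Coset.map (GlobalMonoid.toAdelicHom L)))
    (n : ℕ) : HeckeAlg.pull _ hbij (adelicSeries L n) = globalSeries L n := by
  classical
  rcases Nat.eq_zero_or_pos n with rfl | hn
  · simp
  refine HeckeAlg.ext_coeff fun α => ?_
  rw [HeckeAlg.coeff_pull]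
  have h1 : adelicSeries L n = sumOfIndex (AdelicMonoid.indexHom L) n := if_neg hn.ne'
  have h2 : globalSeries L n = sumOfIndex (InjEnd.indexHom ℤ L) n := if_neg hn.ne'
  rw [h1, h2, HeckeAlg.coeff_sumOfIndex (InjEnd.indexHom ℤ L) GlobalMonoid.finitenessConditions hn,
    HeckeAlg.coeff_sumOfIndex (AdelicMonoid.indexHom L) (AdelicMonoid.finitenessConditions fun _ =>
      AdelicMonoid.finite_setOf_index_eq hbij.2) hn]
  refine if_congr ?_ rfl rfl
  rw [show AdelicMonoid.indexHom L (GlobalMonoid.toAdelicHom L α) = InjEnd.indexHom ℤ L α from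
    GlobalMonoid.index_toAdelic α]

end Series

/-- Ring homomorphisms are compatible with formal Euler products. -/
theorem HasFormalEulerProduct.map {A B : Type*} [Ring A] [Ring B] (η : A →+* B)
    {F : Nat.Primes → ArithmeticFunction A} {D : ArithmeticFunction A}
    (h : HasFormalEulerProduct F D) {F' : Nat.Primes → ArithmeticFunction B}
    {D' : ArithmeticFunction B} (hF : ∀ p n, η (F p n) = F' p n) (hD : ∀ n, η (D n) = D' n) :
    HasFormalEulerProduct F' D' := by
  intro n
  obtain ⟨S, hS⟩ := h n
  refine ⟨S, fun l hl hSl => ?_⟩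
  rw [← hD, ← hS l hl hSl]
  clear hS hl hSl
  induction l generalizing n with
  | nil =>
    by_cases hn : n = 1
    · subst hn
      simp
    · simp [ArithmeticFunction.one_apply_ne hn]
  | cons p l ih =>
    rw [List.map_cons, List.map_cons, List.prod_cons, List.prod_cons, ArithmeticFunction.mul_apply,
      ArithmeticFunction.mul_apply, map_sum]
    exact Finset.sum_congr rfl fun z _ => by rw [map_mul, hF, ih]

theorem evalPrimePow_map {A B : Type*} [Ring A] [Ring B] (η : A →+* B) (p : Nat.Primes)
    (P : PowerSeries A) (n : ℕ) :
    η (evalPrimePow p P n) = evalPrimePow p (PowerSeries.map η P) n := by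
  by_cases h : ∃ k, (p : ℕ) ^ k = n
  · obtain ⟨k, rfl⟩ := h
    rw [evalPrimePow_apply_pow, evalPrimePow_apply_pow, PowerSeries.coeff_map]
  · rw [evalPrimePow_apply_of_forall_ne p _ h, evalPrimePow_apply_of_forall_ne p _ h, map_zero]

theorem theorem4 :
    Hecke.FinitenessConditions (M := GlobalMonoid Heisenberg) InjEnd.index ∧
    Hecke.FinitenessConditions (M := AdelicMonoid Heisenberg) AdelicMonoid.index ∧
    (∀ p : Nat.Primes,
      Hecke.FinitenessConditions (M := LocalMonoid Heisenberg p) InjEnd.index) ∧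
    ∃ (ι : ∀ p : Nat.Primes, LocalHecke Heisenberg p →+* AdelicHecke Heisenberg)
      (η : AdelicHecke Heisenberg →+* GlobalHecke Heisenberg),
      -- `ι p` is the embedding of rings given by the inclusion of the local monoid at `p`
      (∀ p : Nat.Primes, Function.Injective (ι p) ∧
        ∀ α : LocalMonoid Heisenberg p, ι p (HeckeAlg.T α) = HeckeAlg.T α.toAdelic) ∧
      -- `η` is the embedding of rings which sends a double coset to the sum of all
      -- double cosets contained in its preimage under the diagonal embedding
      (Function.Injective η ∧
        ∀ (x : AdelicHecke Heisenberg) (β : GlobalMonoid Heisenberg),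
          (η x).coeff β = x.coeff β.toAdelic) ∧
      -- the two Dirichlet series agree
      (∀ n : ℕ, η (adelicSeries Heisenberg n) = globalSeries Heisenberg n) ∧
      -- the Euler products
      HasFormalEulerProduct
        (fun p => evalPrimePow p (PowerSeries.map (ι p) (localSeries Heisenberg p)))
        (adelicSeries Heisenberg) ∧
      HasFormalEulerProduct
        (fun p => evalPrimePow p
          (PowerSeries.map (η.comp (ι p)) (localSeries Heisenberg p)))
        (globalSeries Heisenberg) := by
  have hbij := Heisenberg.map_toAdelicHom_bijective
  have hfin : ∀ n, 0 < n → {c : Hecke.Coset (AdelicMonoid Heisenberg) |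
      c.index (AdelicMonoid.indexHom Heisenberg) = n}.Finite := fun _ =>
    AdelicMonoid.finite_setOf_index_eq hbij.2
  refine ⟨GlobalMonoid.finitenessConditions, AdelicMonoid.finitenessConditions hfin,
    LocalMonoid.finitenessConditions hfin, LocalHecke.toAdelic Heisenberg,
    HeckeAlg.pull _ hbij, fun p => ⟨?_, fun α => ?_⟩, ⟨HeckeAlg.pull_injective _ hbij, fun _ _ => rfl⟩,
    pull_adelicSeries hbij, hasFormalEulerProduct_adelicSeries hfin, ?_⟩
  · exact HeckeAlg.push_injective _ _ (LocalMonoid.map_toAdelicHom_injective p)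
  · exact HeckeAlg.push_T _ _ (LocalMonoid.map_toAdelicHom_injective p)
      (LocalMonoid.finitenessConditions hfin p).1 (AdelicMonoid.finitenessConditions hfin).1 α
  · refine (hasFormalEulerProduct_adelicSeries hfin).map (HeckeAlg.pull _ hbij) (fun p n => ?_)
      (pull_adelicSeries hbij)
    rw [evalPrimePow_map]
    rfl
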